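/- For $v=(p,q)\in\mathbb Z^2$ with $\gcd(p,q)=1$ (a primitive vector; up to sign these are the homology classes of the essential simple closed curves in the torus) let $T_v\in SL(2,\mathbb Z)=\mathrm{Mod}(\mathbb T^2)$ be the Dehn twist about the corresponding curve, i.e. the transvection $T_v(w)=w+\langle v,w\rangle v$ with $\langle v,w\rangle=v_1w_2-v_2w_1$, so that $T_v=\begin{pmatrix}1-pq&p^2\\-q^2&1+pq\end{pmatrix}$. For an integer $s\ge 1$ let $N_s\le SL(2,\mathbb Z)$ be the subgroup generated by the powers $T_v^s$ over all primitive $v$, and let $\Gamma_s$ be the principal congruence subgroup of level $s$ (the matrices in $SL(2,\mathbb Z)$ congruent to the identity modulo $s$). Write $F_k$ for the free group of rank $k$, $F_\infty$ for the free group of countably infinite rank, and $C_2$ for the cyclic group of order two. Then: 1. $N_1=SL(2,\mathbb Z)$, $N_2\cong F_2\times C_2$, $N_3\cong F_3$, $N_4\cong F_5$, $N_5\cong F_{11}$, and $N_s\cong F_\infty$ for every $s\ge 6$. 2. $N_s=\Gamma_s$ for $1\le s\le 5$, and the index of $N_s$ in $SL(2,\mathbb Z)$ is $1,6,24,48,120$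 for $s=1,2,3,4,5$ respectively. For every $s\ge 6$, $N_s$ is contained in $\Gamma_s$ and has infinite index in $\Gamma_s$ and in $SL(2,\mathbb Z)$. 3. For $s=3,4,5$ let $V_s$ be the following list of primitive vectors: - $V_3$: $(1,0),(0,1),(1,1),(1,-1)$; - $V_4$: $(1,0),(0,1),(1,1),(1,-1),(1,2),(2,1)$; - $V_5$: $(1,0),(0,1),(1,1),(1,-1),(1,2),(2,1),(1,-2),(-2,1),(2,3),(-2,3),(2,5),(5,2)$. For every $u\in V_s$, the elements $T_v^s$ with $v\in V_s$, $v\ne u$, freely generate $N_s$. -/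

import Mathlib

open scoped MatrixGroups

namespace TorusTwists

/-- The first homology group `H₁(𝕋²; ℤ) = ℤ²` of the torus. -/
abbrev H1 : Type := Fin 2 → ℤ

/-- The algebraic intersection number `⟨v, w⟩` of two homology classes of the torus. -/
def algInt (v w : H1) : ℤ := v 0 * w 1 - v 1 * w 0

/-- A homology class is primitive if its coordinates have greatest common divisor `1`.
Up to sign, the primitive classes correspond to the isotopy classes of essential simple closed
curves in the torus. -/
def IsPrimitive (v : H1) : Prop := Int.gcd (v 0) (v 1) = 1

/-- The (right-handed) Dehn twist about the simple closed curve with homology class `v`, as an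
element of `Mod(𝕋²) = SL(2, ℤ)`. It is the transvection `w ↦ w + ⟨v, w⟩ v` of `ℤ²`;
see `dehnTwist_mulVec`. -/
def dehnTwist (v : H1) : SL(2, ℤ) :=
  ⟨!![1 - v 0 * v 1, v 0 ^ 2; -(v 1) ^ 2, 1 + v 0 * v 1], by
    rw [Matrix.det_fin_two_of]; ring⟩

theorem dehnTwist_mulVec (v w : H1) :
    (dehnTwist v : Matrix (Fin 2) (Fin 2) ℤ).mulVec w = w + algInt v w • v := by
  ext i
  fin_cases i <;>
    simp [dehnTwist, algInt, Matrix.mulVec, dotProduct, Fin.sum_univ_two] <;> ring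

/-- The Dehn twist does not depend on the orientation of the curve. -/
theorem dehnTwist_neg (v : H1) : dehnTwist (-v) = dehnTwist v := by
  ext i j
  fin_cases i <;> fin_cases j <;> simp [dehnTwist]

/-- The subgroup `N_s` of `SL(2, ℤ)` generated by the `s`-th powers of all Dehn twists. -/
def N (s : ℕ) : Subgroup SL(2, ℤ) :=
  Subgroup.closure {g | ∃ v : H1, IsPrimitive v ∧ g = dehnTwist v ^ s}

/-- The family `f` of elements of `G` freely generates the subgroup `K`. -/
def FreelyGenerates {G ι : Type*} [Group G] (f : ι → G) (K : Subgroup G) : Prop :=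
  Function.Injective (FreeGroup.lift f) ∧ (FreeGroup.lift f).range = K

/-- The primitive vectors listed for `s = 3`. -/
def vectors3 : Fin 4 → H1 :=
  ![![1, 0], ![0, 1], ![1, 1], ![1, -1]]

/-- The primitive vectors listed for `s = 4`. -/
def vectors4 : Fin 6 → H1 :=
  ![![1, 0], ![0, 1], ![1, 1], ![1, -1], ![1, 2], ![2, 1]]

/-- The primitive vectors listed for `s = 5`. -/
def vectors5 : Fin 12 → H1 :=
  ![![1, 0], ![0, 1], ![1, 1], ![1, -1], ![1, 2], ![2, 1],
    ![1, -2], ![-2, 1], ![2, 3], ![-2, 3], ![2, 5], ![5, 2]]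

end TorusTwists

/-! ### `PSL(2, ℤ)` as a free product of cyclic groups of orders two and three -/

namespace TorusTwists

open UpperHalfPlane Monoid Subgroup
open scoped Pointwise

/-! Every primitive vector is the first column of a matrix in `SL(2, ℤ)`, so every twist is a
conjugate of `T`, and `N s` is the normal closure of `T ^ s` (`N_eq_normalClosure`). Modulo `± 1`,
`SL(2, ℤ)` is the free product of the groups generated by `S` (order two) and `modU` (order three),
and `T` becomes their product `modU * S`. Hence the quotient by `N s` and `± 1` is the `(2, 3, s)`
triangle group, which is finite for `s ≤ 5` and infinite for `s ≥ 6`.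

For `s ≥ 6`, the free product is mapped to inner automorphisms of a group of complex matrices so
that `T` goes to a matrix of trace `2 cos (π / s)`. Its `s`-th power is scalar, so `N s` is killed.
The commutator of `S` and `modU` goes to a non-scalar matrix of trace at least `2`, which has
infinite projective order (`commutator_pow_notMem_N`); this gives the infinite index. The image of
`N s` in `PSL(2, ℤ)` is normal and contains neither free factor's generator, so the action groupoid
on its cosets is free and so is each vertex group (`IsFreeProductTwoThree.isFreeGroup`). An
equivariant crossed homomorphism shows that a normal subgroup of infinite index containing a
positive power of `υ * σ` is not finitely generated (`IsFreeProductTwoThree.not_fg_ker`), so the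
rank is infinite.

For `2 ≤ s ≤ 5`, a finite table lists the cosets of `± Γ_s` and a Schreier cocycle with values in a
free group `F` on chosen twist powers. The free product property turns the table into an action of
`SL(2, ℤ)` on states times `F`. Each chosen twist power fixes the base state and multiplies the `F`
coordinate by its own generator, so these powers are free. Following an element from the base state
writes it, up to sign, as a coset representative times a word in the powers; since the
representatives are distinct modulo `± Γ_s`, elements of `Γ_s` are words up to sign
(`exists_eq_lift_of_mem_Gamma`). For `s = 3, 4, 5` the listed vectors represent the cusps of a
sphere with 4, 6 or 12 punctures; the product of their twist powers in a suitable order is trivial,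
so any one of them can be omitted. -/

/-- The homomorphism from a cyclic group determined by an element whose `n`-th power is trivial. -/
def powHom {X : Type*} [Group X] (n : ℕ) (x : X) (hx : x ^ n = 1) :
    Multiplicative (ZMod n) →* X :=
  AddMonoidHom.toMultiplicativeLeft
    (ZMod.lift n ⟨zmultiplesHom (Additive X) (Additive.ofMul x), by
      simpa [← ofMul_pow] using hx⟩)

theorem powHom_intCast {X : Type*} [Group X] (n : ℕ) (x : X) (hx : x ^ n = 1) (k : ℤ) :
    powHom n x hx (Multiplicative.ofAdd (k : ZMod n)) = x ^ k := by
  simp only [powHom, AddMonoidHom.toMultiplicativeLeft_apply_apply, toAdd_ofAdd, ZMod.lift_coe]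
  simp [← ofMul_zpow]

theorem powHom_one {X : Type*} [Group X] (n : ℕ) (x : X) (hx : x ^ n = 1) :
    powHom n x hx (Multiplicative.ofAdd 1) = x := by
  simpa using powHom_intCast n x hx 1

/-- `P` is the free product of the subgroup of order two generated by `σ` and the subgroup of order
three generated by `υ`, expressed through its universal property. -/
structure IsFreeProductTwoThree {P : Type} [Group P] (σ υ : P) : Prop where
  sq : σ ^ 2 = 1
  cube : υ ^ 3 = 1
  closure_eq_top : Subgroup.closure {σ, υ} = ⊤
  exists_lift : ∀ (X : Type) [Group X] (a b : X), a ^ 2 = 1 → b ^ 3 = 1 →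
    ∃ φ : P →* X, φ σ = a ∧ φ υ = b

/-- The matrix of the order three rotation `z ↦ 1 - 1 / z` of the upper half plane. -/
def modU : SL(2, ℤ) := ModularGroup.T * ModularGroup.S

theorem S_sq : ModularGroup.S ^ 2 = -1 := by decide

theorem modU_cube : modU ^ 3 = -1 := by decide

theorem T_eq_neg_modU_mul_S : ModularGroup.T = -(modU * ModularGroup.S) := by decide

theorem closure_S_modU : Subgroup.closure {ModularGroup.S, modU} = ⊤ := by
  rw [eq_top_iff, ← SpecialLinearGroup.SL2Z_generators, closure_le]
  have hS : ModularGroup.S ∈ Subgroup.closure {ModularGroup.S, modU} := subset_closure (by simp)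
  have hU : modU ∈ Subgroup.closure {ModularGroup.S, modU} := subset_closure (by simp)
  rintro x (rfl | rfl)
  · exact hS
  · have : ModularGroup.T = modU * ModularGroup.S⁻¹ := by simp [modU]
    rw [this]
    exact mul_mem hU (inv_mem hS)

/-- The modular group `PSL(2, ℤ)`, realised as a group of permutations of the upper half plane. -/
noncomputable def modularAction : SL(2, ℤ) →* Equiv.Perm ℍ := MulAction.toPermHom _ _

theorem modularAction_neg (g : SL(2, ℤ)) : modularAction (-g) = modularAction g := by
  ext z : 1
  exact ModularGroup.SL_neg_smul g z

theorem modularAction_neg_one : modularAction (-1) = 1 := by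
  rw [modularAction_neg, map_one]

theorem modularAction_S_sq : modularAction ModularGroup.S ^ 2 = 1 := by
  rw [← map_pow, S_sq, modularAction_neg_one]

theorem modularAction_modU_cube : modularAction modU ^ 3 = 1 := by
  rw [← map_pow, modU_cube, modularAction_neg_one]

theorem re_S_smul (z : ℍ) : (ModularGroup.S • z).re = -z.re / Complex.normSq z := by
  rw [UpperHalfPlane.modular_S_smul]
  change ((-(z : ℂ))⁻¹).re = _
  simp [Complex.inv_re, neg_div]

theorem re_modU_smul (z : ℍ) : (modU • z).re = 1 - z.re / Complex.normSq z := by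
  rw [modU, mul_smul, ModularGroup.re_T_smul, re_S_smul]
  ring

theorem re_modU_inv_smul_pos (z : ℍ) (hz : z.re < 0) : 0 < (modU⁻¹ • z).re := by
  rw [modU, mul_inv_rev, mul_smul]
  have : ModularGroup.S⁻¹ = -ModularGroup.S := by decide
  rw [this, ModularGroup.SL_neg_smul, re_S_smul, ModularGroup.re_T_inv_smul]
  exact div_pos (by linarith) (UpperHalfPlane.normSq_pos _)

theorem exists_modularAction_range_lift (X : Type) [Group X] (a b : X) (ha : a ^ 2 = 1)
    (hb : b ^ 3 = 1) : ∃ φ : modularAction.range →* X,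
      φ (modularAction.rangeRestrict ModularGroup.S) = a ∧
      φ (modularAction.rangeRestrict modU) = b := by
  let H : Fin 2 → Type := fun i => Multiplicative (ZMod (i + 2))
  let _ : ∀ i, Group (H i) := fun i => inferInstanceAs (Group (Multiplicative (ZMod (i + 2))))
  let f : ∀ i, H i →* Equiv.Perm ℍ := fun i => match i with
    | 0 => powHom 2 (modularAction ModularGroup.S) modularAction_S_sq
    | 1 => powHom 3 (modularAction modU) modularAction_modU_cube
  let g : ∀ i, H i →* X := fun i => match i with
    | 0 => powHom 2 a ha
    | 1 => powHom 3 b hb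
  have hinj : Function.Injective (CoprodI.lift f) := by
    -- Ping-pong on the two open half planes left and right of the imaginary axis: `S` moves the
    -- right one into the left one, and both nontrivial powers of `modU` move the left one into the
    -- right one.
    let Y : Fin 2 → Set ℍ := fun i => match i with
      | 0 => {z | z.re < 0}
      | 1 => {z | 0 < z.re}
    apply CoprodI.lift_injective_of_ping_pong f _ Y
    · intro i
      fin_cases i
      · exact ⟨⟨-1 + Complex.I, by simp⟩, by change ((_ : ℂ)).re < 0; simp⟩
      · exact ⟨⟨1 + Complex.I, by simp⟩, by change 0 < ((_ : ℂ)).re; simp⟩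
    · intro i j hij
      rw [Function.onFun, Set.disjoint_left]
      intro z
      fin_cases i <;> fin_cases j <;> simp [Y] at hij ⊢ <;> intro h <;> exact h.le
    · have h0 : ∀ h : Multiplicative (ZMod 2), h ≠ 1 → h = Multiplicative.ofAdd 1 := by decide
      have h1 : ∀ h : Multiplicative (ZMod 3), h ≠ 1 →
        h = Multiplicative.ofAdd 1 ∨ h = (Multiplicative.ofAdd 1)⁻¹ := by decide
      intro i j hij
      fin_cases i <;> fin_cases j <;> first | exact absurd rfl hij | skip
      · intro h hh
        rw [h0 h hh]
        change powHom 2 _ _ _ • {z : ℍ | 0 < z.re} ⊆ {z : ℍ | z.re < 0}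
        rw [powHom_one]
        rintro _ ⟨z, hz, rfl⟩
        change (ModularGroup.S • z).re < 0
        rw [re_S_smul]
        exact div_neg_of_neg_of_pos (neg_neg_of_pos hz) (UpperHalfPlane.normSq_pos _)
      · intro h hh
        change powHom 3 _ _ _ • {z : ℍ | z.re < 0} ⊆ {z : ℍ | 0 < z.re}
        rintro _ ⟨z, hz, rfl⟩
        rcases h1 h hh with rfl | rfl
        · rw [powHom_one]
          change 0 < (modU • z).re
          rw [re_modU_smul]
          have := div_neg_of_neg_of_pos hz (UpperHalfPlane.normSq_pos z)
          linarith
        · rw [map_inv, powHom_one, ← map_inv]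
          exact re_modU_inv_smul_pos z hz
    -- Ping-pong also needs a factor with at least three elements; the factor of order three serves.
    · right
      exact ⟨1, by simp [H]⟩
  have hfS : CoprodI.lift f (CoprodI.of (M := H) (i := 0) (Multiplicative.ofAdd (1 : ZMod 2))) =
      modularAction ModularGroup.S := by
    rw [CoprodI.lift_of]
    exact powHom_one _ _ _
  have hfU : CoprodI.lift f (CoprodI.of (M := H) (i := 1) (Multiplicative.ofAdd (1 : ZMod 3))) =
      modularAction modU := by
    rw [CoprodI.lift_of]
    exact powHom_one _ _ _
  have hle : modularAction.range ≤ (CoprodI.lift f).range := by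
    rw [MonoidHom.range_eq_map, ← closure_S_modU, MonoidHom.map_closure, closure_le]
    rintro _ ⟨x, rfl | rfl, rfl⟩
    · exact ⟨_, hfS⟩
    · exact ⟨_, hfU⟩
  let e := MonoidHom.ofInjective hinj
  refine ⟨(CoprodI.lift g).comp (e.symm.toMonoidHom.comp (inclusion hle)), ?_, ?_⟩
  · have : e.symm (inclusion hle (modularAction.rangeRestrict ModularGroup.S)) =
        CoprodI.of (M := H) (i := 0) (Multiplicative.ofAdd (1 : ZMod 2)) := by
      rw [MulEquiv.symm_apply_eq]
      exact Subtype.ext hfS.symm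
    change CoprodI.lift g (e.symm _) = a
    rw [this, CoprodI.lift_of]
    exact powHom_one _ _ _
  · have : e.symm (inclusion hle (modularAction.rangeRestrict modU)) =
        CoprodI.of (M := H) (i := 1) (Multiplicative.ofAdd (1 : ZMod 3)) := by
      rw [MulEquiv.symm_apply_eq]
      exact Subtype.ext hfU.symm
    change CoprodI.lift g (e.symm _) = b
    rw [this, CoprodI.lift_of]
    exact powHom_one _ _ _

/-- `PSL(2, ℤ)` is the free product of cyclic groups of orders two and three. -/
theorem isFreeProductTwoThree_modularAction_range :
    IsFreeProductTwoThree (modularAction.rangeRestrict ModularGroup.S)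
      (modularAction.rangeRestrict modU) where
  sq := Subtype.ext modularAction_S_sq
  cube := Subtype.ext modularAction_modU_cube
  closure_eq_top := by
    have := congrArg (map modularAction.rangeRestrict) closure_S_modU
    rwa [MonoidHom.map_closure, Set.image_pair,
      map_top_of_surjective _ modularAction.rangeRestrict_surjective] at this
  exists_lift X _ a b ha hb := exists_modularAction_range_lift X a b ha hb

/-- Elements `a`, `b` with `a ^ 2 = b ^ 3 = 1` define a homomorphism on `SL(2, ℤ)`. -/
theorem exists_modular_lift {X : Type} [Group X] (a b : X) (ha : a ^ 2 = 1) (hb : b ^ 3 = 1) :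
    ∃ φ : SL(2, ℤ) →* X, φ ModularGroup.S = a ∧ φ modU = b := by
  obtain ⟨φ, h1, h2⟩ := exists_modularAction_range_lift X a b ha hb
  exact ⟨φ.comp modularAction.rangeRestrict, h1, h2⟩

/-- Two points of the imaginary axis suffice: fixing `t * I` forces `a = d` and `b = -c * t ^ 2`,
and `t = 1, 2` together give `b = c = 0`. -/
theorem eq_one_or_eq_neg_one_of_modularAction_eq_one {g : SL(2, ℤ)} (hg : modularAction g = 1) :
    g = 1 ∨ g = -1 := by
  have key : ∀ t : ℝ, 0 < t → (g 0 0 : ℝ) = g 1 1 ∧ (g 0 1 : ℝ) = -(g 1 0) * t ^ 2 := by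
    intro t ht
    let z : ℍ := ⟨t * Complex.I, by simpa using ht⟩
    have h : g • z = z := DFunLike.congr_fun hg z
    have h' := congrArg (fun w : ℍ => (w : ℂ)) h
    have hz : (z : ℂ) = t * Complex.I := rfl
    simp only [UpperHalfPlane.coe_specialLinearGroup_apply, hz] at h'
    rw [div_eq_iff] at h'
    · have h1 := congrArg Complex.re h'
      have h2 := congrArg Complex.im h'
      simp at h1 h2
      constructor
      · exact mul_right_cancel₀ ht.ne' (by linarith)
      · linarith
    · exact UpperHalfPlane.denom_ne_zero (g : GL (Fin 2) ℝ) z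
  obtain ⟨h1, h2⟩ := key 1 one_pos
  obtain ⟨-, h3⟩ := key 2 two_pos
  have hd : g 0 0 = g 1 1 := by exact_mod_cast h1
  have hc : g 1 0 = 0 := by
    have : (g 1 0 : ℝ) = 0 := by linarith
    exact_mod_cast this
  have hb : g 0 1 = 0 := by
    have : (g 0 1 : ℝ) = 0 := by rw [h2, hc]; simp
    exact_mod_cast this
  have hdet := Matrix.det_fin_two g.1
  rw [g.2] at hdet
  change 1 = g 0 0 * g 1 1 - g 0 1 * g 1 0 at hdet
  rw [← hd, hb, zero_mul, sub_zero] at hdet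
  rcases Int.eq_one_or_neg_one_of_mul_eq_one hdet.symm with h | h
  · left
    ext i j
    fin_cases i <;> fin_cases j <;> simp [hb, hc, h, ← hd]
  · right
    ext i j
    fin_cases i <;> fin_cases j <;> simp [hb, hc, h, ← hd]

end TorusTwists

/-! ### Powers of twists as conjugates of `T ^ s`, and congruence subgroups -/

namespace TorusTwists

open Subgroup

theorem dehnTwist_pow (v : H1) (s : ℕ) :
    ((dehnTwist v ^ s : SL(2, ℤ)) : Matrix (Fin 2) (Fin 2) ℤ) =
      !![1 - s * (v 0 * v 1), s * v 0 ^ 2; -(s * (v 1) ^ 2), 1 + s * (v 0 * v 1)] := by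
  induction s with
  | zero => simp [Matrix.one_fin_two]
  | succ n ih =>
    rw [pow_succ, Matrix.SpecialLinearGroup.coe_mul, ih]
    simp only [dehnTwist, Matrix.mul_fin_two]
    push_cast
    congr 1
    ext i j
    fin_cases i <;> fin_cases j <;> simp <;> ring

theorem det_eq_one_fin_two (g : SL(2, ℤ)) : g 0 0 * g 1 1 - g 0 1 * g 1 0 = 1 := by
  rw [← Matrix.det_fin_two, g.det_coe]

/-- `T` is the twist along `(1, 0)`, and conjugating a transvection by `g` moves its vector by `g`.
-/
theorem dehnTwist_firstColumn (g : SL(2, ℤ)) :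
    dehnTwist ![g 0 0, g 1 0] = g * ModularGroup.T * g⁻¹ := by
  have hdet := det_eq_one_fin_two g
  rw [eq_mul_inv_iff_mul_eq]
  ext i j
  rw [Matrix.SpecialLinearGroup.coe_mul, Matrix.SpecialLinearGroup.coe_mul, ModularGroup.coe_T]
  fin_cases i <;> fin_cases j <;> simp [dehnTwist, Matrix.mul_apply, Fin.sum_univ_two]
  · ring
  · linear_combination g 0 0 * hdet
  · ring
  · linear_combination g 1 0 * hdet

theorem isPrimitive_firstColumn (g : SL(2, ℤ)) : IsPrimitive ![g 0 0, g 1 0] := by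
  have hdet := det_eq_one_fin_two g
  refine Int.isCoprime_iff_gcd_eq_one.mp ⟨g 1 1, -g 0 1, ?_⟩
  simp only [Matrix.cons_val_zero, Matrix.cons_val_one]
  linear_combination hdet

theorem IsPrimitive.exists_firstColumn {v : H1} (hv : IsPrimitive v) :
    ∃ g : SL(2, ℤ), v = ![g 0 0, g 1 0] := by
  obtain ⟨a, b, h⟩ := Int.isCoprime_iff_gcd_eq_one.mpr hv
  refine ⟨⟨!![v 0, -b; v 1, a], by rw [Matrix.det_fin_two_of]; linear_combination h⟩, ?_⟩
  ext i
  fin_cases i <;> simp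

/-- Bézout completes a primitive vector to a matrix, so the generators of `N s` are exactly the
conjugates of `T ^ s`. -/
theorem N_eq_normalClosure (s : ℕ) : N s = normalClosure {ModularGroup.T ^ s} := by
  rw [N, normalClosure]
  congr 1
  ext x
  rw [Group.conjugatesOfSet, Set.biUnion_singleton]
  change _ ↔ IsConj _ _
  rw [isConj_iff]
  constructor
  · rintro ⟨v, hv, rfl⟩
    obtain ⟨g, rfl⟩ := hv.exists_firstColumn
    exact ⟨g, by rw [dehnTwist_firstColumn, conj_pow]⟩
  · rintro ⟨g, rfl⟩
    exact ⟨_, isPrimitive_firstColumn g, by rw [dehnTwist_firstColumn, conj_pow]⟩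

instance N_normal (s : ℕ) : (N s).Normal := by
  rw [N_eq_normalClosure]
  infer_instance

theorem T_pow_mem_N (s : ℕ) : ModularGroup.T ^ s ∈ N s := by
  rw [N_eq_normalClosure]
  exact subset_normalClosure rfl

theorem N_le_of_T_pow_mem {s : ℕ} {K : Subgroup SL(2, ℤ)} [K.Normal]
    (h : ModularGroup.T ^ s ∈ K) : N s ≤ K := by
  rw [N_eq_normalClosure]
  exact normalClosure_le_normal (by simpa using h)

theorem N_le_Gamma (s : ℕ) : N s ≤ CongruenceSubgroup.Gamma s := by
  have := CongruenceSubgroup.Gamma_normal s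
  apply N_le_of_T_pow_mem
  exact_mod_cast CongruenceSubgroup.ModularGroup_T_pow_mem_Gamma s s dvd_rfl

theorem N_one : N 1 = ⊤ := by
  rw [eq_top_iff, ← SpecialLinearGroup.SL2Z_generators, closure_le]
  have hmem : ∀ v, IsPrimitive v → dehnTwist v ∈ N 1 := fun v hv =>
    subset_closure ⟨v, hv, (pow_one _).symm⟩
  have hT : ModularGroup.T ∈ N 1 := by simpa using T_pow_mem_N 1
  rintro x (rfl | rfl)
  · have : ModularGroup.S =
        ModularGroup.T⁻¹ * (dehnTwist ![0, 1])⁻¹ * ModularGroup.T⁻¹ := by decide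
    rw [this]
    exact mul_mem (mul_mem (inv_mem hT) (inv_mem (hmem _ (by simp [IsPrimitive])))) (inv_mem hT)
  · exact hT

/-- A congruence `-1 ≡ 1` modulo `s` would make `s` divide `2`. -/
theorem neg_one_notMem_Gamma {s : ℕ} (hs : 3 ≤ s) :
    (-1 : SL(2, ℤ)) ∉ CongruenceSubgroup.Gamma s := by
  rw [CongruenceSubgroup.Gamma_mem]
  rintro ⟨h, -⟩
  have h2 : ((2 : ℕ) : ZMod s) = 0 := by
    simp at h
    have : (2 : ZMod s) = 1 - (-1) := by ring
    rw [Nat.cast_ofNat, this, h, sub_self]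
  rw [ZMod.natCast_eq_zero_iff] at h2
  exact absurd (Nat.le_of_dvd two_pos h2) (by omega)

end TorusTwists

/-! ### Infinite index for `s ≥ 6`, by projective representations of triangle groups -/

namespace TorusTwists

open Subgroup

/-- The sequence of Chebyshev type that governs the powers of a matrix of determinant one and
trace `t`. -/
def traceSeq (t : ℝ) : ℕ → ℝ
  | 0 => 0
  | 1 => 1
  | n + 2 => t * traceSeq t (n + 1) - traceSeq t n

/-- The hypothesis is Cayley–Hamilton for determinant one and trace `t`. A power is therefore scalar
as soon as its `traceSeq` coefficient vanishes. -/
theorem pow_succ_eq_traceSeq {R : Type*} [Ring R] [Algebra ℝ R] {M : R} {t : ℝ}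
    (hM : M * M = t • M - 1) (n : ℕ) :
    M ^ (n + 1) = traceSeq t (n + 1) • M - traceSeq t n • (1 : R) := by
  induction n with
  | zero => simp [traceSeq]
  | succ n ih =>
    rw [pow_succ, ih, sub_mul, smul_mul_assoc, smul_mul_assoc, hM, one_mul, traceSeq]
    module

theorem natCast_le_traceSeq {t : ℝ} (ht : 2 ≤ t) (n : ℕ) : (n : ℝ) ≤ traceSeq t n := by
  -- The induction carries the increments: for `t ≥ 2` they do not decrease, and the first one is
  -- `1`.
  have key : (n : ℝ) ≤ traceSeq t n ∧ 1 ≤ traceSeq t (n + 1) - traceSeq t n := by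
    induction n with
    | zero => simp [traceSeq]
    | succ n ih =>
      have h0 : (0 : ℝ) ≤ n := n.cast_nonneg
      push_cast
      rw [traceSeq]
      constructor
      · linarith
      · nlinarith
  exact key.1

theorem traceSeq_two_mul_cos (θ : ℝ) (n : ℕ) :
    traceSeq (2 * Real.cos θ) n * Real.sin θ = Real.sin (n * θ) := by
  induction n using Nat.twoStepInduction with
  | zero => simp [traceSeq]
  | one => simp [traceSeq]
  | more n ih1 ih2 =>
    rw [traceSeq, sub_mul, mul_assoc, ih1, ih2]
    have h1 : ((n + 2 : ℕ) : ℝ) * θ = ((n + 1 : ℕ) : ℝ) * θ + θ := by push_cast; ring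
    have h2 : (n : ℝ) * θ = ((n + 1 : ℕ) : ℝ) * θ - θ := by push_cast; ring
    rw [h1, h2, Real.sin_add, Real.sin_sub]
    ring

theorem traceSeq_two_mul_cos_pi_div {s : ℕ} (hs : 2 ≤ s) :
    traceSeq (2 * Real.cos (Real.pi / s)) s = 0 := by
  have h := traceSeq_two_mul_cos (Real.pi / s) s
  have hs0 : (0 : ℝ) < s := by positivity
  rw [mul_div_cancel₀ _ hs0.ne', Real.sin_pi] at h
  refine (mul_eq_zero.mp h).resolve_right (Real.sin_pos_of_pos_of_lt_pi (by positivity) ?_).ne'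
  rw [div_lt_iff₀ hs0]
  have : (2 : ℝ) ≤ s := by exact_mod_cast hs
  nlinarith [Real.pi_pos]

/-- This is where `s ≥ 6` enters: `2 cos (π / 6) = √3`, so the commutator trace `z ^ 2 - 1` is at
least `2`. -/
theorem three_le_sq_two_mul_cos_pi_div {s : ℕ} (hs : 6 ≤ s) :
    3 ≤ (2 * Real.cos (Real.pi / s)) ^ 2 := by
  have hs6 : (6 : ℝ) ≤ s := by exact_mod_cast hs
  have hle : Real.pi / s ≤ Real.pi / 6 :=
    div_le_div_of_nonneg_left Real.pi_pos.le (by norm_num) hs6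
  have h := Real.cos_le_cos_of_nonneg_of_le_pi (by positivity) (by linarith [Real.pi_pos]) hle
  rw [Real.cos_pi_div_six] at h
  have h3 : Real.sqrt 3 ^ 2 = 3 := Real.sq_sqrt (by norm_num)
  nlinarith [Real.sqrt_nonneg 3]

theorem mul_self_eq_of_det_eq_one {M : Matrix (Fin 2) (Fin 2) ℂ} {t : ℝ} (hdet : M.det = 1)
    (htr : M.trace = t) : M * M = t • M - 1 := by
  rw [Matrix.det_fin_two] at hdet
  rw [Matrix.trace_fin_two] at htr
  ext i j
  fin_cases i <;> fin_cases j <;>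
    simp only [Matrix.mul_apply, Fin.sum_univ_two, Matrix.sub_apply, Matrix.smul_apply,
      Complex.real_smul, ← htr, Matrix.one_apply, Fin.zero_eta, Fin.mk_one, Fin.isValue,
      if_true, zero_ne_one, one_ne_zero, if_false] <;>
    first | ring1 | linear_combination -hdet

/-- Matrices `A`, `B` of projective orders two and three whose product has a prescribed trace. -/
theorem exists_units_of_trace (z : ℝ) (hz : z ≠ 0) :
    ∃ A B : (Matrix (Fin 2) (Fin 2) ℂ)ˣ, A ^ 2 = -1 ∧ B ^ 3 = -1 ∧
      ((B * A : (Matrix (Fin 2) (Fin 2) ℂ)ˣ) : Matrix (Fin 2) (Fin 2) ℂ).det = 1 ∧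
      ((B * A : (Matrix (Fin 2) (Fin 2) ℂ)ˣ) : Matrix (Fin 2) (Fin 2) ℂ).trace = z ∧
      ((A * B * A⁻¹ * B⁻¹ : (Matrix (Fin 2) (Fin 2) ℂ)ˣ) : Matrix (Fin 2) (Fin 2) ℂ).det = 1 ∧
      ((A * B * A⁻¹ * B⁻¹ : (Matrix (Fin 2) (Fin 2) ℂ)ˣ) : Matrix (Fin 2) (Fin 2) ℂ).trace =
        (z ^ 2 - 1 : ℝ) ∧
      ((A * B * A⁻¹ * B⁻¹ : (Matrix (Fin 2) (Fin 2) ℂ)ˣ) : Matrix (Fin 2) (Fin 2) ℂ) 0 1 ≠ 0 := by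
  -- `e` is a primitive sixth root of unity, so that the eigenvalues `e` and `1 - e` of `B` have
  -- product `1` and `B ^ 3 = -1`.
  obtain ⟨e, he⟩ : ∃ e : ℂ, e * e = e - 1 := by
    refine ⟨1 / 2 + (Real.sqrt 3 : ℂ) / 2 * Complex.I, ?_⟩
    have h3 : (Real.sqrt 3 : ℂ) ^ 2 = 3 := by
      exact_mod_cast congrArg (Complex.ofReal) (Real.sq_sqrt (show (0 : ℝ) ≤ 3 by norm_num))
    linear_combination (1 / 4 : ℂ) * Complex.I ^ 2 * h3 + 3 / 4 * Complex.I_sq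
  have hI := Complex.I_mul_I
  have he0 : e ≠ 0 := by
    rintro rfl
    norm_num at he
  -- The free entry `m` of `B` is tuned to give `B * A` the trace `z`. The trace of the commutator
  -- then follows from the traces `0`, `1`, `z` of `A`, `B`, `B * A`.
  obtain ⟨m, hm⟩ : ∃ m : ℂ, m = z - Complex.I * (2 * e - 1) := ⟨_, rfl⟩
  let A : (Matrix (Fin 2) (Fin 2) ℂ)ˣ :=
    ⟨!![Complex.I, 1; 0, -Complex.I], !![-Complex.I, -1; 0, Complex.I],
      by simp [Matrix.one_fin_two], by simp [Matrix.one_fin_two]⟩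
  let B : (Matrix (Fin 2) (Fin 2) ℂ)ˣ :=
    ⟨!![e, 0; m, 1 - e], !![1 - e, 0; -m, e],
      by
        rw [Matrix.one_fin_two, Matrix.mul_fin_two]
        ext i j
        fin_cases i <;> fin_cases j <;> simp <;> first | ring1 | linear_combination -he,
      by
        rw [Matrix.one_fin_two, Matrix.mul_fin_two]
        ext i j
        fin_cases i <;> fin_cases j <;> simp <;> first | ring1 | linear_combination -he⟩
  have hBA : ((B * A : (Matrix (Fin 2) (Fin 2) ℂ)ˣ) : Matrix (Fin 2) (Fin 2) ℂ) =
      !![e, 0; m, 1 - e] * !![Complex.I, 1; 0, -Complex.I] := rfl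
  have hC : ((A * B * A⁻¹ * B⁻¹ : (Matrix (Fin 2) (Fin 2) ℂ)ˣ) : Matrix (Fin 2) (Fin 2) ℂ) =
      !![Complex.I, 1; 0, -Complex.I] * !![e, 0; m, 1 - e] * !![-Complex.I, -1; 0, Complex.I] *
        !![1 - e, 0; -m, e] := rfl
  refine ⟨A, B, ?_, ?_, ?_, ?_, ?_, ?_, ?_⟩
  · ext i j
    change (!![Complex.I, 1; 0, -Complex.I] ^ 2) i j = (-1 : Matrix (Fin 2) (Fin 2) ℂ) i j
    rw [sq, Matrix.mul_fin_two, Matrix.one_fin_two]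
    fin_cases i <;> fin_cases j <;> simp
  · ext i j
    change (!![e, 0; m, 1 - e] ^ 3) i j = (-1 : Matrix (Fin 2) (Fin 2) ℂ) i j
    rw [pow_three, Matrix.mul_fin_two, Matrix.mul_fin_two, Matrix.one_fin_two]
    fin_cases i <;> fin_cases j <;> simp
    · linear_combination (e + 1) * he
    · linear_combination m * he
    · linear_combination (2 - e) * he
  · rw [hBA, Matrix.det_mul, Matrix.det_fin_two_of, Matrix.det_fin_two_of]
    linear_combination (-e * (1 - e)) * hI - he
  · rw [hBA, Matrix.mul_fin_two, Matrix.trace_fin_two_of]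
    linear_combination hm
  · rw [hC, Matrix.det_mul, Matrix.det_mul, Matrix.det_mul]
    simp only [Matrix.det_fin_two_of]
    have h1 : e * (1 - e) = 1 := by linear_combination -he
    have h2 : Complex.I * -Complex.I = 1 := by linear_combination -hI
    have h3 : -Complex.I * Complex.I = 1 := by linear_combination -hI
    have h4 : (1 - e) * e = 1 := by linear_combination -he
    simp only [h1, h2, h3, h4, zero_mul, mul_zero, sub_zero, mul_one]
  · rw [hC, Matrix.mul_fin_two, Matrix.mul_fin_two, Matrix.mul_fin_two, Matrix.trace_fin_two_of]
    push_cast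
    have hz' : (z : ℂ) = m + Complex.I * (2 * e - 1) := by rw [hm]; ring
    rw [hz']
    linear_combination (2 * e ^ 2 - 2 * e - 4 * e ^ 2 + 4 * e - 1) * hI + 2 * he
  · rw [hC, Matrix.mul_fin_two, Matrix.mul_fin_two, Matrix.mul_fin_two]
    have : (z : ℂ) ≠ 0 := by exact_mod_cast hz
    convert neg_ne_zero.mpr (mul_ne_zero he0 this) using 1
    simp
    rw [hm]
    ring

theorem commutator_pow_notMem_N {s : ℕ} (hs : 6 ≤ s) {n : ℕ} (hn : n ≠ 0) :
    (ModularGroup.S * modU * ModularGroup.S⁻¹ * modU⁻¹) ^ n ∉ N s := by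
  have hz := three_le_sq_two_mul_cos_pi_div hs
  have hseq := traceSeq_two_mul_cos_pi_div (s := s) (by omega)
  set z := 2 * Real.cos (Real.pi / s)
  obtain ⟨A, B, hA, hB, hd, ht, hd', ht', hC⟩ :=
    exists_units_of_trace z (by rintro h; rw [h] at hz; norm_num at hz)
  -- Conjugation kills scalars, so `MulAut.conj` plays the role of passing to the projective group.
  have hneg : MulAut.conj (-1 : (Matrix (Fin 2) (Fin 2) ℂ)ˣ) = 1 := by
    ext x : 1
    simp [MulAut.conj_apply]
  obtain ⟨φ, hφS, hφU⟩ := exists_modular_lift (MulAut.conj A) (MulAut.conj B)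
    (by rw [← map_pow, hA, hneg]) (by rw [← map_pow, hB, hneg])
  have hφneg : φ (-1) = 1 := by
    rw [← S_sq, map_pow, hφS, ← map_pow, hA, hneg]
  have hφT : φ ModularGroup.T = MulAut.conj (B * A) := by
    rw [T_eq_neg_modU_mul_S, ← neg_one_mul, map_mul, hφneg, one_mul, map_mul, hφS, hφU, map_mul]
  have hN : N s ≤ φ.ker := by
    apply N_le_of_T_pow_mem
    obtain ⟨k, rfl⟩ : ∃ k, s = k + 1 := ⟨s - 1, by omega⟩
    have hpow := pow_succ_eq_traceSeq (mul_self_eq_of_det_eq_one hd ht) k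
    rw [hseq, zero_smul, zero_sub] at hpow
    rw [MonoidHom.mem_ker, map_pow, hφT, ← map_pow]
    ext x : 1
    rw [MulAut.conj_apply, MulAut.one_apply, mul_inv_eq_iff_eq_mul]
    apply Units.ext
    rw [Units.val_mul, Units.val_mul, Units.val_pow_eq_pow_val, hpow]
    simp
  intro hmem
  have h1 := hN hmem
  rw [MonoidHom.mem_ker, map_pow, map_mul, map_mul, map_mul, map_inv, map_inv, hφS, hφU,
    ← map_inv, ← map_inv, ← map_mul, ← map_mul, ← map_mul, ← map_pow] at h1
  obtain ⟨k, rfl⟩ := Nat.exists_eq_succ_of_ne_zero hn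
  have hpow := pow_succ_eq_traceSeq (mul_self_eq_of_det_eq_one hd' ht') k
  -- A test matrix: commuting with `D` forces the upper right entry to vanish, whereas that entry of
  -- the power is a positive `traceSeq` value times a nonzero entry.
  let D : (Matrix (Fin 2) (Fin 2) ℂ)ˣ := ⟨!![1, 0; 0, -1], !![1, 0; 0, -1],
    by simp [Matrix.one_fin_two], by simp [Matrix.one_fin_two]⟩
  have h2 := DFunLike.congr_fun h1 D
  rw [MulAut.conj_apply, MulAut.one_apply, mul_inv_eq_iff_eq_mul] at h2
  generalize A * B * A⁻¹ * B⁻¹ = c at hpow hC h2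
  have h3 := congrArg (fun u : (Matrix (Fin 2) (Fin 2) ℂ)ˣ => (u : Matrix (Fin 2) (Fin 2) ℂ)) h2
  simp only [Units.val_mul, Units.val_pow_eq_pow_val] at h3
  rw [Nat.succ_eq_add_one, hpow] at h3
  have h4 := congrFun (congrFun h3 0) 1
  have hle := natCast_le_traceSeq (t := z ^ 2 - 1) (by linarith) (k + 1)
  have hne : (traceSeq (z ^ 2 - 1) (k + 1) : ℂ) ≠ 0 := by
    rw [Complex.ofReal_ne_zero]
    push_cast at hle
    have : (0 : ℝ) ≤ k := k.cast_nonneg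
    linarith
  simp [D, Matrix.mul_apply, Fin.sum_univ_two] at h4
  exact mul_ne_zero hne hC (by linear_combination (-1 / 2 : ℂ) * h4)

theorem infinite_quotient_N {s : ℕ} (hs : 6 ≤ s) : Infinite (SL(2, ℤ) ⧸ N s) := by
  by_contra hfin
  rw [not_infinite_iff_finite] at hfin
  obtain ⟨n, hn, h⟩ := isOfFinOrder_iff_pow_eq_one.mp (isOfFinOrder_of_finite
    ((ModularGroup.S * modU * ModularGroup.S⁻¹ * modU⁻¹ : SL(2, ℤ)) : SL(2, ℤ) ⧸ N s))
  rw [← QuotientGroup.mk_pow, QuotientGroup.eq_one_iff] at h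
  exact commutator_pow_notMem_N hs hn.ne' h

/-- `Γ_s` has finite index, so finite index of `N s` in it would give finite index in `SL(2, ℤ)`. -/
theorem infinite_Gamma_quotient_N {s : ℕ} (hs : 6 ≤ s) :
    Infinite (CongruenceSubgroup.Gamma s ⧸ (N s).subgroupOf (CongruenceSubgroup.Gamma s)) := by
  by_contra hfin
  rw [not_infinite_iff_finite] at hfin
  have : NeZero s := ⟨by omega⟩
  have h1 : (N s).relIndex (CongruenceSubgroup.Gamma s) ≠ 0 :=
    Subgroup.index_ne_zero_of_finite
  have h2 : (CongruenceSubgroup.Gamma s).index ≠ 0 :=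
    (CongruenceSubgroup.Gamma_is_cong_sub s).finiteIndex.index_ne_zero
  have h3 : (N s).index ≠ 0 := by
    rw [← relIndex_mul_index (N_le_Gamma s)]
    exact mul_ne_zero h1 h2
  have : (N s).FiniteIndex := ⟨h3⟩
  have := infinite_quotient_N hs
  exact not_finite (SL(2, ℤ) ⧸ N s)

end TorusTwists

/-! ### Freeness of normal subgroups, by free action groupoids -/

namespace TorusTwists

open Subgroup CategoryTheory CategoryTheory.ActionCategory CategoryTheory.SingleObj Quiver

/-- The representative of least value in each orbit of an element of order three. -/
def orbitMin {P A : Type} [Group P] [MulAction P A] [LinearOrder A] (υ : P) : Set A :=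
  {a | a < υ • a ∧ a < υ⁻¹ • a}

namespace IsFreeProductTwoThree

variable {P A : Type} [Group P] [MulAction P A] [LinearOrder A] {σ υ : P}

omit [LinearOrder A] in
theorem smul_smul_sq (h : IsFreeProductTwoThree σ υ) (a : A) : σ • σ • a = a := by
  rw [← mul_smul, ← _root_.sq, h.sq, one_smul]

theorem inv_sq (h : IsFreeProductTwoThree σ υ) : σ⁻¹ = σ :=
  inv_eq_of_mul_eq_one_left (by rw [← _root_.sq, h.sq])

omit [LinearOrder A] in
theorem inv_inv_smul (h : IsFreeProductTwoThree σ υ) (a : A) : υ⁻¹ • υ⁻¹ • a = υ • a := by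
  rw [← mul_smul, inv_smul_eq_iff.symm, ← mul_smul]
  have : υ⁻¹ * (υ⁻¹ * υ⁻¹) = 1 := by
    have := h.cube
    rw [pow_three] at this
    rw [← mul_inv_rev, ← mul_inv_rev, mul_assoc, this, inv_one]
  rw [this, one_smul]

theorem hom_ext (h : IsFreeProductTwoThree σ υ) {X : Type*} [Group X] {φ ψ : P →* X}
    (h1 : φ σ = ψ σ) (h2 : φ υ = ψ υ) : φ = ψ := by
  apply MonoidHom.eq_of_eqOn_dense h.closure_eq_top
  rintro x (rfl | rfl)
  · exact h1
  · exact h2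

omit [LinearOrder A] in
-- The function coordinate of `F σ ^ 2 = 1`: crossing a `σ`-edge and returning has trivial label.
theorem semidirect_left_sq (h : IsFreeProductTwoThree σ υ) {X : Type} [Group X]
    (F : P →* (A → X) ⋊[mulAutArrow] P) (hF : SemidirectProduct.rightHom.comp F = MonoidHom.id P)
    (b : A) : (F σ).left b * (F σ).left (σ • b) = 1 := by
  have hr : (F σ).right = σ := DFunLike.congr_fun hF σ
  have h1 : (F σ * F σ).left b = 1 := by
    rw [← map_mul, ← _root_.sq, h.sq, map_one]; rfl
  rw [SemidirectProduct.mul_left, hr] at h1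
  have h2 : (F σ).left b * (F σ).left (σ⁻¹ • b) = 1 := h1
  rwa [h.inv_sq] at h2

omit [LinearOrder A] in
theorem semidirect_left_cube (h : IsFreeProductTwoThree σ υ) {X : Type} [Group X]
    (F : P →* (A → X) ⋊[mulAutArrow] P) (hF : SemidirectProduct.rightHom.comp F = MonoidHom.id P)
    (b : A) : (F υ).left b * ((F υ).left (υ⁻¹ • b) * (F υ).left (υ • b)) = 1 := by
  have hr : (F υ).right = υ := DFunLike.congr_fun hF υ
  have h1 : (F υ * (F υ * F υ)).left b = 1 := by
    rw [← map_mul, ← map_mul, ← pow_three, h.cube, map_one]; rfl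
  rw [SemidirectProduct.mul_left, SemidirectProduct.mul_left, hr] at h1
  have h2 : (F υ).left b * ((F υ).left (υ⁻¹ • b) * (F υ).left (υ⁻¹ • υ⁻¹ • b)) = 1 := h1
  rwa [h.inv_inv_smul] at h2

theorem mem_orbitMin_smul (h : IsFreeProductTwoThree σ υ) (a : A) :
    υ • a ∈ orbitMin υ ↔ υ • a < υ⁻¹ • a ∧ υ • a < a := by
  rw [orbitMin, Set.mem_ofPred_eq, inv_smul_smul, ← h.inv_inv_smul (υ • a), inv_smul_smul]

theorem mem_orbitMin_inv_smul (h : IsFreeProductTwoThree σ υ) (a : A) :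
    υ⁻¹ • a ∈ orbitMin υ ↔ υ⁻¹ • a < a ∧ υ⁻¹ • a < υ • a := by
  rw [orbitMin, Set.mem_ofPred_eq, smul_inv_smul, h.inv_inv_smul]

theorem orbitMin_cases (h : IsFreeProductTwoThree σ υ) (hυ : ∀ a : A, υ • a ≠ a) (a : A) :
    (a ∈ orbitMin υ ∧ υ • a ∉ orbitMin υ ∧ υ⁻¹ • a ∉ orbitMin υ) ∨
    (a ∉ orbitMin υ ∧ υ • a ∈ orbitMin υ ∧ υ⁻¹ • a ∉ orbitMin υ) ∨
    (a ∉ orbitMin υ ∧ υ • a ∉ orbitMin υ ∧ υ⁻¹ • a ∈ orbitMin υ) := by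
  rw [h.mem_orbitMin_smul, h.mem_orbitMin_inv_smul, orbitMin, Set.mem_ofPred_eq]
  have h1 := hυ a
  have h2 : υ⁻¹ • a ≠ a := fun h' => h1 (by rw [← h', smul_inv_smul, h'])
  have h3 : υ⁻¹ • a ≠ υ • a := fun h' => hυ (υ⁻¹ • υ⁻¹ • a) (by
    rw [smul_inv_smul, h.inv_inv_smul, h'])
  grind

/-- A section into the semidirect product is a labelling of the edges of the action graph by `X`,
with trivial product around every `σ`-orbit and `υ`-orbit. As orbits have full size, one label per
`σ`-orbit and two per `υ`-orbit can be prescribed freely and determine the rest. -/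
theorem existsUnique_semidirect_lift (h : IsFreeProductTwoThree σ υ) (hσ : ∀ a : A, σ • a ≠ a)
    (hυ : ∀ a : A, υ • a ≠ a) {X : Type} [Group X] (e₂ e₃ : A → X) :
    ∃! F : P →* (A → X) ⋊[mulAutArrow] P,
      SemidirectProduct.rightHom.comp F = MonoidHom.id P ∧
      (∀ b, σ • b < b → (F σ).left b = e₂ b) ∧ (∀ b, b ∉ orbitMin υ → (F υ).left b = e₃ b) := by
  classical
  refine existsUnique_of_exists_of_unique ?_ ?_
  · let m₂ : A → X := fun b => if σ • b < b then e₂ b else (e₂ (σ • b))⁻¹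
    -- At the least point of a `υ`-orbit the label is forced by the other two.
    let m₃ : A → X := fun b =>
      if b ∈ orbitMin υ then (e₃ (υ⁻¹ • b) * e₃ (υ • b))⁻¹ else e₃ b
    obtain ⟨F, hF₂, hF₃⟩ := h.exists_lift ((A → X) ⋊[mulAutArrow] P) ⟨m₂, σ⟩ ⟨m₃, υ⟩ (by
      rw [_root_.sq]
      ext b
      · change m₂ b * m₂ (σ⁻¹ • b) = 1
        rw [h.inv_sq]
        simp only [m₂, h.smul_smul_sq]
        rcases lt_or_gt_of_ne (hσ b) with hb | hb
        · rw [if_pos hb, if_neg hb.le.not_gt, mul_inv_cancel]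
        · rw [if_neg hb.le.not_gt, if_pos hb, inv_mul_cancel]
      · change σ * σ = 1
        rw [← _root_.sq, h.sq]) (by
      rw [pow_three]
      ext b
      · change m₃ b * (m₃ (υ⁻¹ • b) * m₃ (υ⁻¹ • υ⁻¹ • b)) = 1
        rw [h.inv_inv_smul]
        have h3 : υ • υ • b = υ⁻¹ • b := by
          rw [← h.inv_inv_smul (υ • b), inv_smul_smul]
        simp only [m₃]
        rcases h.orbitMin_cases hυ b with ⟨h1, h2, h4⟩ | ⟨h1, h2, h4⟩ | ⟨h1, h2, h4⟩ <;>
          simp [h1, h2, h4, h3, h.inv_inv_smul]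
      · change υ * (υ * υ) = 1
        rw [← pow_three, h.cube])
    refine ⟨F, h.hom_ext ?_ ?_, fun b hb => ?_, fun b hb => ?_⟩
    · simp [hF₂]
    · simp [hF₃]
    · simp [hF₂, m₂, hb]
    · simp [hF₃, m₃, hb]
  · rintro F G ⟨hF, hF₂, hF₃⟩ ⟨hG, hG₂, hG₃⟩
    apply h.hom_ext
    · apply SemidirectProduct.ext
      · funext b
        rcases lt_or_gt_of_ne (hσ b) with hb | hb
        · rw [hF₂ b hb, hG₂ b hb]
        · have h1 := h.semidirect_left_sq F hF b
          have h2 := h.semidirect_left_sq G hG b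
          rw [hF₂ (σ • b) (by rwa [h.smul_smul_sq])] at h1
          rw [hG₂ (σ • b) (by rwa [h.smul_smul_sq])] at h2
          exact (eq_inv_of_mul_eq_one_left h1).trans (eq_inv_of_mul_eq_one_left h2).symm
      · exact (DFunLike.congr_fun hF σ).trans (DFunLike.congr_fun hG σ).symm
    · apply SemidirectProduct.ext
      · funext b
        have h1 := h.semidirect_left_cube F hF b
        have h2 := h.semidirect_left_cube G hG b
        rcases h.orbitMin_cases hυ b with ⟨hb, hb', hb''⟩ | ⟨hb, -, -⟩ | ⟨hb, -, -⟩
        · rw [hF₃ _ hb', hF₃ _ hb''] at h1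
          rw [hG₃ _ hb', hG₃ _ hb''] at h2
          rw [eq_inv_of_mul_eq_one_left h1, eq_inv_of_mul_eq_one_left h2]
        · rw [hF₃ b hb, hG₃ b hb]
        · rw [hF₃ b hb, hG₃ b hb]
      · exact (DFunLike.congr_fun hF υ).trans (DFunLike.congr_fun hG υ).symm

/-- The action groupoid of a free product of cyclic groups of orders two and three is free as soon
as both cyclic groups act freely. -/
@[reducible]
def isFreeGroupoid (h : IsFreeProductTwoThree σ υ) (hσ : ∀ a : A, σ • a ≠ a)
    (hυ : ∀ a : A, υ • a ≠ a) : IsFreeGroupoid (ActionCategory P A) where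
  quiverGenerators := ⟨fun a b => PLift (a.back < b.back ∧ σ • a.back = b.back) ⊕
      PLift (b.back ∉ orbitMin (A := A) υ ∧ υ • a.back = b.back)⟩
  of := fun e => e.elim (fun e => ⟨σ, e.down.2⟩) (fun e => ⟨υ, e.down.2⟩)
  unique_lift := by
    classical
    intro X _ f
    let e₂ : A → X := fun b => if hb : σ • b < b then
      @f ⟨(), σ⁻¹ • b⟩ ⟨(), b⟩ (Sum.inl ⟨by rwa [h.inv_sq], smul_inv_smul _ _⟩) else 1
    let e₃ : A → X := fun b => if hb : b ∉ orbitMin υ then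
      @f ⟨(), υ⁻¹ • b⟩ ⟨(), b⟩ (Sum.inr ⟨hb, smul_inv_smul _ _⟩) else 1
    -- Functors from the action groupoid to `X` correspond, by currying, to sections of the
    -- semidirect product over `P`.
    obtain ⟨F', ⟨hF, hF₂, hF₃⟩, uF⟩ := h.existsUnique_semidirect_lift hσ hυ e₂ e₃
    refine ⟨uncurry F' fun g => DFunLike.congr_fun hF g, ?_, ?_⟩
    · rintro ⟨⟨⟩, a : A⟩ ⟨⟨⟩, b : A⟩ (⟨⟨h1 : a < b, h2 : σ • a = b⟩⟩ | ⟨⟨h1 : b ∉ _, h2 : υ • a = b⟩⟩)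
      · change (F' σ).left b = _
        obtain rfl : a = σ⁻¹ • b := by rw [← h2, inv_smul_smul]
        rw [h.inv_sq] at h1
        rw [hF₂ b h1]
        simp only [e₂, dif_pos h1]
      · change (F' υ).left b = _
        obtain rfl : a = υ⁻¹ • b := by rw [← h2, inv_smul_smul]
        rw [hF₃ b h1]
        simp only [e₃, dif_pos h1]
    · intro E hE
      have hc : curry E = F' := by
        apply uF
        refine ⟨rfl, fun b hb => ?_, fun b hb => ?_⟩
        · simp only [e₂, dif_pos hb]
          convert! hE ⟨(), σ⁻¹ • b⟩ ⟨(), b⟩ (Sum.inl ⟨by rwa [h.inv_sq], smul_inv_smul _ _⟩)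
        · simp only [e₃, dif_pos hb]
          convert! hE ⟨(), υ⁻¹ • b⟩ ⟨(), b⟩ (Sum.inr ⟨hb, smul_inv_smul _ _⟩)
      apply Functor.hext
      · intro
        apply Unit.ext
      · refine ActionCategory.cases ?_
        intro t g
        exact heq_of_eq (congrFun (congrArg SemidirectProduct.left (DFunLike.congr_fun hc g)) t)

end IsFreeProductTwoThree

/-- A normal subgroup of `C₂ * C₃` that contains neither of the two generators is free. -/
theorem IsFreeProductTwoThree.isFreeGroup {P : Type} [Group P] {σ υ : P}
    (h : IsFreeProductTwoThree σ υ) (K : Subgroup P) [K.Normal] (hσ : σ ∉ K) (hυ : υ ∉ K) :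
    IsFreeGroup K := by
  -- Any linear order will do: it only selects a representative in each orbit.
  let _ : LinearOrder (P ⧸ K) := IsWellOrder.linearOrder WellOrderingRel
  -- If `x` fixes the coset of `g`, then `g⁻¹ * x * g` lies in `K`, hence so does `x` by normality.
  have key : ∀ x : P, x ∉ K → ∀ a : P ⧸ K, x • a ≠ a := by
    intro x hx a
    induction a using QuotientGroup.induction_on with
    | H g =>
      intro he
      rw [MulAction.Quotient.smul_coe, smul_eq_mul] at he
      have h1 := QuotientGroup.eq.mp he.symm
      apply hx
      rw [← mul_assoc] at h1
      have := ‹K.Normal›.conj_mem _ h1 g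
      simpa [mul_assoc] using this
  have := h.isFreeGroupoid (A := P ⧸ K) (key σ hσ) (key υ hυ)
  have hconn : @CategoryTheory.IsConnected (ActionCategory P (P ⧸ K)) _ := inferInstance
  have hfree := @IsFreeGroupoid.endIsFreeOfConnectedFree (ActionCategory P (P ⧸ K)) _ hconn this
    (objEquiv P (P ⧸ K) ((1 : P) : P ⧸ K))
  let x : ActionCategory P (P ⧸ K) := objEquiv P (P ⧸ K) ((1 : P) : P ⧸ K)
  let _ : Group (End x) := End.group x
  let e : End x ≃* K :=
    { toEquiv := (endMulEquivSubgroup K).toEquiv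
      map_mul' := fun a b => (endMulEquivSubgroup K).map_mul' a b }
  have : IsFreeGroup (End x) := hfree
  exact IsFreeGroup.ofMulEquiv e

end TorusTwists

/-! ### Failure of finite generation, by a crossed homomorphism -/

namespace TorusTwists

open Subgroup

section DerivationOnFreeProduct

variable {P D : Type} [Group P] [Group D] {σ υ : P}

/-- The affine permutation `f ↦ g • f + m` of the integer valued functions on a group `D`. -/
def affinePerm (g : D) (m : D → ℤ) : Equiv.Perm (D → ℤ) where
  toFun f w := f (g⁻¹ * w) + m w
  invFun f w := f (g * w) - m (g * w)
  left_inv f := by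
    funext w
    simp
  right_inv f := by
    funext w
    simp

/-- The crossed homomorphism on a free product of cyclic groups of orders two and three with values
in the functions on a quotient, sending `σ` to `1 - σ` and `υ` to `0`. -/
theorem IsFreeProductTwoThree.exists_crossedHom [DecidableEq D] (h : IsFreeProductTwoThree σ υ)
    (π : P →* D) :
    ∃ d : P → D → ℤ, (∀ x y w, d (x * y) w = d y ((π x)⁻¹ * w) + d x w) ∧
      (∀ w, d σ w = (if w = 1 then 1 else 0) - (if w = π σ then 1 else 0)) ∧ ∀ w, d υ w = 0 := by
  have hσ : π σ * π σ = 1 := by rw [← map_mul, ← _root_.sq, h.sq, map_one]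
  have hσ' : (π σ)⁻¹ = π σ := inv_eq_of_mul_eq_one_left hσ
  have hυ : π υ * (π υ * π υ) = 1 := by rw [← map_mul, ← map_mul, ← pow_three, h.cube, map_one]
  -- A crossed homomorphism is the translation part of an action by affine maps, so the universal
  -- property supplies it. The relation for `σ` holds because `(1 + σ)(1 - σ) = 0`.
  obtain ⟨φ, h1, h2⟩ := h.exists_lift (Equiv.Perm (D → ℤ))
    (affinePerm (π σ) fun w => (if w = 1 then 1 else 0) - (if w = π σ then 1 else 0))
    (affinePerm (π υ) 0)
    (by
      ext f w
      change f ((π σ)⁻¹ * ((π σ)⁻¹ * w)) + ((if (π σ)⁻¹ * w = 1 then 1 else 0) -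
        (if (π σ)⁻¹ * w = π σ then 1 else 0)) +
        ((if w = 1 then 1 else 0) - (if w = π σ then 1 else 0)) = f w
      simp only [inv_mul_eq_iff_eq_mul, mul_one, hσ]
      rw [hσ', ← mul_assoc, hσ, one_mul]
      ring)
    (by
      ext f w
      change f ((π υ)⁻¹ * ((π υ)⁻¹ * ((π υ)⁻¹ * w))) + 0 + 0 + 0 = f w
      have : (π υ)⁻¹ * ((π υ)⁻¹ * ((π υ)⁻¹ * w)) = (π υ * (π υ * π υ))⁻¹ * w := by group
      rw [this, hυ, inv_one, one_mul, add_zero, add_zero, add_zero])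
  have key : ∀ x f w, φ x f w = f ((π x)⁻¹ * w) + φ x 0 w := by
    intro x
    have hx : x ∈ Subgroup.closure {σ, υ} := by rw [h.closure_eq_top]; trivial
    induction hx using Subgroup.closure_induction with
    | mem x hx =>
      intro f w
      rcases hx with rfl | rfl
      · rw [h1]; simp [affinePerm]
      · rw [h2]; simp [affinePerm]
    | one => intro f w; simp
    | mul a b _ _ ha hb =>
      intro f w
      rw [map_mul, Equiv.Perm.mul_apply, Equiv.Perm.mul_apply, ha, hb, ha (φ b 0), map_mul,
        mul_inv_rev, mul_assoc, add_assoc]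
    | inv a _ ha =>
      intro f w
      have h3 : ∀ f, φ a⁻¹ f = fun w => f (π a * w) - φ a 0 (π a * w) := by
        intro f
        rw [map_inv, Equiv.Perm.inv_eq_iff_eq]
        funext w
        rw [ha]
        simp
      rw [h3, h3]
      simp
      ring
  refine ⟨fun x => φ x 0, fun x y w => ?_, fun w => ?_, fun w => ?_⟩
  · beta_reduce
    rw [map_mul, Equiv.Perm.mul_apply, key]
  · simp [h1, affinePerm]
  · simp [h2, affinePerm]

/-- Otherwise both generators' images are powers of `π (υ * σ)`. Then `D` is cyclic, generated by an
element of order dividing `6`, hence finite. -/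
theorem IsFreeProductTwoThree.notMem_zpowers_of_infinite [Infinite D]
    (h : IsFreeProductTwoThree σ υ) {π : P →* D} (hπ : Function.Surjective π) :
    π σ ∉ zpowers (π (υ * σ)) := by
  intro hmem
  have hσ : π σ ^ 2 = 1 := by rw [← map_pow, h.sq, map_one]
  have hυ : π υ ^ 3 = 1 := by rw [← map_pow, h.cube, map_one]
  have hυmem : π υ ∈ zpowers (π (υ * σ)) := by
    have : π υ = π (υ * σ) * (π σ)⁻¹ := by rw [map_mul, mul_inv_cancel_right]
    rw [this]
    exact mul_mem (mem_zpowers _) (inv_mem hmem)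
  have hcomm : Commute (π υ) (π σ) := by
    obtain ⟨k, hk⟩ := mem_zpowers_iff.mp hmem
    obtain ⟨l, hl⟩ := mem_zpowers_iff.mp hυmem
    rw [← hk, ← hl]
    exact Commute.zpow_zpow_self _ _ _
  have hfin : IsOfFinOrder (π (υ * σ)) := by
    refine isOfFinOrder_iff_pow_eq_one.mpr ⟨6, by norm_num, ?_⟩
    rw [map_mul, hcomm.mul_pow]
    rw [show 6 = 3 * 2 from rfl, pow_mul, hυ, one_pow, mul_comm 3 2, pow_mul, hσ, one_pow, one_mul]
  have htop : zpowers (π (υ * σ)) = ⊤ := by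
    rw [eq_top_iff, ← map_top_of_surjective π hπ, ← h.closure_eq_top, MonoidHom.map_closure,
      closure_le]
    rintro _ ⟨x, rfl | rfl, rfl⟩
    · exact hmem
    · exact hυmem
  have h1 : Finite (zpowers (π (υ * σ))) := by
    have := hfin.finite_zpowers
    exact this
  rw [htop] at h1
  have : Finite D := Finite.of_equiv _ (Subgroup.topEquiv (G := D)).toEquiv
  exact not_finite D

/-- The kernel of a homomorphism onto an infinite group that contains a power of `υ * σ`
is not finitely generated. -/
theorem IsFreeProductTwoThree.not_fg_ker [Infinite D] (h : IsFreeProductTwoThree σ υ) {π : P →* D}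
    (hπ : Function.Surjective π) {s : ℕ} (hs : s ≠ 0) (hker : (υ * σ) ^ s ∈ π.ker) :
    ¬ π.ker.FG := by
  classical
  obtain ⟨d, hmul, hσ, hυ⟩ := h.exists_crossedHom π
  have hone : ∀ w, d 1 w = 0 := by
    intro w
    have := hmul 1 1 w
    rw [mul_one, map_one, inv_one, one_mul] at this
    linarith
  have hinv : ∀ x w, d x⁻¹ w = -d x (π x * w) := by
    intro x w
    have := hmul x x⁻¹ (π x * w)
    rw [mul_inv_cancel, hone, inv_mul_cancel_left] at this
    linarith
  have hfin : ∀ x, (Function.support (d x)).Finite := by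
    intro x
    have hx : x ∈ Subgroup.closure {σ, υ} := by rw [h.closure_eq_top]; trivial
    induction hx using Subgroup.closure_induction with
    | mem x hx =>
      rcases hx with rfl | rfl
      · refine (Set.toFinite {1, π x}).subset fun w hw => ?_
        by_contra hw'
        simp only [Set.mem_insert_iff, Set.mem_singleton_iff, not_or] at hw'
        exact hw (by rw [hσ, if_neg hw'.1, if_neg hw'.2, sub_zero])
      · refine Set.finite_empty.subset fun w hw => hw (hυ w)
    | one => exact Set.finite_empty.subset fun w hw => hw (hone w)
    | mul a b _ _ ha hb =>
      refine ((hb.image (π a * ·)).union ha).subset fun w hw => ?_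
      by_contra hw'
      rw [Set.mem_union, not_or] at hw'
      apply hw
      rw [hmul, Function.notMem_support.mp hw'.2, add_zero]
      by_contra h0
      exact hw'.1 ⟨_, h0, mul_inv_cancel_left _ _⟩
    | inv a _ ha =>
      refine (ha.image ((π a)⁻¹ * ·)).subset fun w hw => ?_
      refine ⟨π a * w, fun h0 => hw ?_, inv_mul_cancel_left _ _⟩
      rw [hinv, h0, neg_zero]
  rintro ⟨t, ht⟩
  -- On the kernel `d` is an ordinary homomorphism, so finitely many generators confine all its
  -- supports to one finite set.
  have hE : ∀ x ∈ π.ker, Function.support (d x) ⊆ ⋃ y ∈ t, Function.support (d y) := by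
    intro x hx
    rw [← ht] at hx
    have hle : ∀ y ∈ Subgroup.closure (t : Set P), π y = 1 := fun y hy => by rwa [ht] at hy
    induction hx using Subgroup.closure_induction with
    | mem y hy => exact Set.subset_biUnion_of_mem (u := fun y => Function.support (d y)) hy
    | one => exact fun w hw => absurd (hone w) hw
    | mul a b ha hb iha ihb =>
      intro w hw
      by_contra hw'
      apply hw
      rw [hmul, hle a ha, inv_one, one_mul, Function.notMem_support.mp fun h' => hw' (iha h'),
        Function.notMem_support.mp fun h' => hw' (ihb h'), add_zero]
    | inv a ha iha =>
      intro w hw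
      refine iha fun h0 => hw ?_
      rw [hinv, hle a ha, one_mul, h0, neg_zero]
  have hσmem := h.notMem_zpowers_of_infinite hπ
  have hυmem : ∀ k : ℤ, π (υ * σ) ^ k * π υ ≠ π (υ * σ) := by
    intro k hk
    apply hσmem
    have h1 : π σ = (π υ)⁻¹ * π (υ * σ) := by rw [map_mul, inv_mul_cancel_left]
    rw [h1, eq_inv_mul_of_mul_eq hk]
    exact mul_mem (inv_mem (mul_mem (inv_mem (zpow_mem (mem_zpowers _) k)) (mem_zpowers _)))
      (mem_zpowers _)
  have hd : ∀ k : ℤ, d (υ * σ) (π (υ * σ) ^ k * π υ) =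
      if π (υ * σ) ^ k * π υ = π υ then 1 else 0 := by
    intro k
    rw [hmul, hσ, hυ, add_zero]
    simp only [inv_mul_eq_iff_eq_mul, mul_one, ← map_mul, if_neg (hυmem k), sub_zero]
  -- The value `-1` of `d (υ * σ)` sits at `π (υ * σ)`, which lies off the coset `⟨π (υ * σ)⟩ * π
  -- υ`; on that coset nothing cancels the value `1` at `π υ`.
  have hnonneg : ∀ (n : ℕ) (k : ℤ), 0 ≤ d ((υ * σ) ^ n) (π (υ * σ) ^ k * π υ) := by
    intro n
    induction n with
    | zero => intro k; rw [pow_zero, hone]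
    | succ n ih =>
      intro k
      rw [pow_succ', hmul, hd, ← mul_assoc, ← zpow_neg_one, ← zpow_add]
      exact add_nonneg (ih _) (by split_ifs <;> norm_num)
  have hpos : d ((υ * σ) ^ s) (π υ) ≠ 0 := by
    obtain ⟨n, rfl⟩ := Nat.exists_eq_succ_of_ne_zero hs
    have h1 := hd 0
    rw [zpow_zero, one_mul, if_pos rfl] at h1
    rw [Nat.succ_eq_add_one, pow_succ', hmul, h1, ← zpow_neg_one]
    have := hnonneg n (-1)
    linarith
  refine Set.infinite_univ (α := D) (((t.finite_toSet.biUnion fun y _ => hfin y)).subset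
    fun w _ => ?_)
  -- Conjugating by `g` translates the support by `π g`, so every `w` is reached and `D` would be
  -- finite.
  obtain ⟨g, hg⟩ := hπ (w * (π υ)⁻¹)
  have hconj : g * (υ * σ) ^ s * g⁻¹ ∈ π.ker := π.normal_ker.conj_mem _ hker g
  refine hE _ hconj fun h0 => hpos ?_
  rw [hmul, hmul, hinv, map_mul, MonoidHom.mem_ker.mp hker, mul_one, mul_inv_cancel_left, hg] at h0
  simpa using h0

end DerivationOnFreeProduct

end TorusTwists

/-! ### The groups `N s` for `s ≥ 6` -/

namespace TorusTwists

open Subgroup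

/-- A countable free group that is not finitely generated is free of countably infinite rank. -/
theorem nonempty_mulEquiv_freeGroup_nat {G : Type} [Group G] [Countable G] [IsFreeGroup G]
    (hG : ¬ Group.FG G) : Nonempty (G ≃* FreeGroup ℕ) := by
  let e : G ≃* FreeGroup (IsFreeGroup.Generators G) := (IsFreeGroup.toFreeGroup G)
  have hcount : Countable (IsFreeGroup.Generators G) :=
    (e.symm.injective.comp FreeGroup.of_injective).countable
  have hinf : Infinite (IsFreeGroup.Generators G) := by
    by_contra hfin
    rw [not_infinite_iff_finite] at hfin
    apply hG
    exact Group.fg_of_surjective (f := e.symm.toMonoidHom) e.symm.surjective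
  obtain ⟨f⟩ := nonempty_equiv_of_countable (α := IsFreeGroup.Generators G) (β := ℕ)
  exact ⟨e.trans (FreeGroup.freeGroupCongr f)⟩

/-- The quotient map from `SL(2, ℤ)` to `PSL(2, ℤ)`. -/
noncomputable abbrev toPSL : SL(2, ℤ) →* modularAction.range := modularAction.rangeRestrict

theorem eq_or_eq_neg_of_toPSL_eq {g h : SL(2, ℤ)} (hgh : toPSL g = toPSL h) : g = h ∨ g = -h := by
  have h1 : modularAction (g * h⁻¹) = 1 := by
    rw [map_mul, map_inv, mul_inv_eq_one]
    exact congrArg Subtype.val hgh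
  rcases eq_one_or_eq_neg_one_of_modularAction_eq_one h1 with h2 | h2
  · exact Or.inl (mul_inv_eq_one.mp h2)
  · right
    rw [mul_inv_eq_iff_eq_mul] at h2
    rw [h2, neg_one_mul]

/-- Squaring removes the sign ambiguity. -/
theorem sq_mem_of_toPSL_mem_map {K : Subgroup SL(2, ℤ)} {g : SL(2, ℤ)}
    (hg : toPSL g ∈ K.map toPSL) : g ^ 2 ∈ K := by
  obtain ⟨m, hm, h⟩ := hg
  rcases eq_or_eq_neg_of_toPSL_eq h.symm with rfl | rfl
  · exact pow_mem hm 2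
  · rw [neg_sq]
    exact pow_mem hm 2

theorem nonempty_N_mulEquiv_freeGroup_nat {s : ℕ} (hs : 6 ≤ s) :
    Nonempty (N s ≃* FreeGroup ℕ) := by
  let f : N s →* modularAction.range := toPSL.comp (N s).subtype
  have hrange : f.range = (N s).map toPSL := by
    rw [MonoidHom.range_comp, range_subtype]
  have hinj : Function.Injective f := by
    rw [injective_iff_map_eq_one]
    intro g hg
    rcases eq_or_eq_neg_of_toPSL_eq (hg.trans toPSL.map_one.symm) with h | h
    · exact Subtype.ext h
    · exact absurd (N_le_Gamma s (h ▸ g.2)) (neg_one_notMem_Gamma (by omega))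
  let e : N s ≃* (N s).map toPSL :=
    (MonoidHom.ofInjective hinj).trans (MulEquiv.subgroupCongr hrange)
  have hnormal : ((N s).map toPSL).Normal :=
    (N_normal s).map _ modularAction.rangeRestrict_surjective
  have hσ : toPSL ModularGroup.S ∉ (N s).map toPSL := by
    intro h
    have h1 := N_le_Gamma s (sq_mem_of_toPSL_mem_map h)
    rw [S_sq] at h1
    exact neg_one_notMem_Gamma (by omega) h1
  -- The upper left entry of `modU ^ 2` is `0`, not `1` modulo `s`.
  have hυ : toPSL modU ∉ (N s).map toPSL := by
    intro h
    have h1 := N_le_Gamma s (sq_mem_of_toPSL_mem_map h)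
    rw [CongruenceSubgroup.Gamma_mem] at h1
    have h2 : (modU ^ 2 : SL(2, ℤ)) 0 0 = 0 := by decide
    have : Fact (1 < s) := ⟨by omega⟩
    rw [h2, Int.cast_zero] at h1
    exact zero_ne_one h1.1
  have hfree := isFreeProductTwoThree_modularAction_range.isFreeGroup _ hσ hυ
  have hinf : Infinite (modularAction.range ⧸ (N s).map toPSL) := by
    by_contra hfin
    rw [not_infinite_iff_finite] at hfin
    obtain ⟨n, hn, h⟩ := isOfFinOrder_iff_pow_eq_one.mp (isOfFinOrder_of_finite
      (toPSL (ModularGroup.S * modU * ModularGroup.S⁻¹ * modU⁻¹) :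
        modularAction.range ⧸ (N s).map toPSL))
    rw [← QuotientGroup.mk_pow, QuotientGroup.eq_one_iff, ← map_pow] at h
    have h1 := sq_mem_of_toPSL_mem_map h
    rw [← pow_mul] at h1
    exact commutator_pow_notMem_N hs (by omega) h1
  have hnfg : ¬ ((N s).map toPSL).FG := by
    have h1 := isFreeProductTwoThree_modularAction_range.not_fg_ker
      (QuotientGroup.mk'_surjective ((N s).map toPSL)) (s := s) (by omega)
    rw [QuotientGroup.ker_mk'] at h1
    refine h1 ⟨_, T_pow_mem_N s, ?_⟩
    rw [map_pow, T_eq_neg_modU_mul_S]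
    congr 1
    rw [← map_mul]
    exact Subtype.ext (modularAction_neg _)
  have : Countable (Matrix (Fin 2) (Fin 2) ℤ) := inferInstanceAs (Countable (Fin 2 → Fin 2 → ℤ))
  have : Countable SL(2, ℤ) := Subtype.countable
  have hc : Countable ((N s).map toPSL) := e.symm.injective.countable
  have hG : ¬ Group.FG ((N s).map toPSL) := by
    rwa [Group.fg_iff_subgroup_fg]
  obtain ⟨e'⟩ := nonempty_mulEquiv_freeGroup_nat hG
  exact ⟨e.trans e'⟩

end TorusTwists

/-! ### Exchanging the omitted generator -/

namespace TorusTwists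

section OmitOne

/-- The letter `i` occurs once, so the relation can be solved for its value. -/
theorem eq_of_prod_map_eq_one {ι H : Type*} [Group H] {l : List ι} (hl : l.Nodup) {i : ι}
    (hi : i ∈ l) {u v : ι → H} (hu : (l.map u).prod = 1) (hv : (l.map v).prod = 1)
    (huv : ∀ j, j ≠ i → u j = v j) : u i = v i := by
  obtain ⟨l₁, l₂, rfl⟩ := List.append_of_mem hi
  have h1 : i ∉ l₁ := fun h => (List.nodup_append.mp hl).2.2 i h i (by simp) rfl
  have h2 : i ∉ l₂ := (List.nodup_cons.mp (List.nodup_append.mp hl).2.1).1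
  have e1 : l₁.map u = l₁.map v :=
    List.map_congr_left fun j hj => huv j fun h => h1 (h ▸ hj)
  have e2 : l₂.map u = l₂.map v :=
    List.map_congr_left fun j hj => huv j fun h => h2 (h ▸ hj)
  rw [List.map_append, List.map_cons, List.prod_append, List.prod_cons] at hu hv
  rw [e1, e2, ← hv] at hu
  exact mul_right_cancel (mul_left_cancel hu)

variable {ι : Type*} [DecidableEq ι]

theorem exists_prod_map_eq_one {l : List ι} (hl : l.Nodup) {i : ι} (hi : i ∈ l) :
    ∃ u : ι → FreeGroup {j : ι // j ≠ i}, (∀ j (h : j ≠ i), u j = FreeGroup.of ⟨j, h⟩) ∧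
      (l.map u).prod = 1 := by
  obtain ⟨l₁, l₂, rfl⟩ := List.append_of_mem hi
  have h1 : i ∉ l₁ := fun h => (List.nodup_append.mp hl).2.2 i h i (by simp) rfl
  have h2 : i ∉ l₂ := (List.nodup_cons.mp (List.nodup_append.mp hl).2.1).1
  let u₀ : ι → FreeGroup {j : ι // j ≠ i} := fun j =>
    if h : j ≠ i then FreeGroup.of ⟨j, h⟩ else 1
  let u := Function.update u₀ i ((l₁.map u₀).prod⁻¹ * (l₂.map u₀).prod⁻¹)
  have hu : ∀ j, j ≠ i → u j = u₀ j := fun j hj => Function.update_of_ne hj _ _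
  refine ⟨u, fun j hj => by rw [hu j hj]; exact dif_pos hj, ?_⟩
  have e1 : l₁.map u = l₁.map u₀ := List.map_congr_left fun j hj => hu j fun h => h1 (h ▸ hj)
  have e2 : l₂.map u = l₂.map u₀ := List.map_congr_left fun j hj => hu j fun h => h2 (h ▸ hj)
  rw [List.map_append, List.map_cons, List.prod_append, List.prod_cons, e1, e2]
  simp [u]

/-- If a product of elements in which each element occurs once is trivial and all but one of the
elements generate a subgroup freely, then the omitted element may be chosen arbitrarily. -/
theorem FreelyGenerates.omit_of_prod_eq_one {G : Type*} [Group G] {g : ι → G} {K : Subgroup G}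
    {l : List ι} (hl : l.Nodup) (hmem : ∀ i, i ∈ l) (hprod : (l.map g).prod = 1) {k : ι}
    (hk : FreelyGenerates (fun j : {j : ι // j ≠ k} => g j) K) (i : ι) :
    FreelyGenerates (fun j : {j : ι // j ≠ i} => g j) K := by
  choose u hu hu' using fun i => exists_prod_map_eq_one hl (hmem i)
  -- `u k j` is the letter `j` written in the free group without `k`. The maps `α i k` and `α k i`
  -- rewrite one basis in terms of the other and are mutually inverse.
  let α : ∀ i k, FreeGroup {j : ι // j ≠ i} →* FreeGroup {j : ι // j ≠ k} :=
    fun i k => FreeGroup.lift fun j => u k j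
  have hα : ∀ i k j, α i k (u i j) = u k j := by
    intro i k
    have hne : ∀ j, j ≠ i → α i k (u i j) = u k j := by
      intro j hj
      rw [hu i j hj]
      exact FreeGroup.lift_apply_of ..
    intro j
    by_cases hj : j = i
    · subst hj
      refine eq_of_prod_map_eq_one (u := fun m => α j k (u j m)) hl (hmem j) ?_ (hu' k) hne
      have := congrArg (α j k) (hu' j)
      rwa [map_list_prod, List.map_map, map_one] at this
    · exact hne j hj
  have hlift : ∀ i j, FreeGroup.lift (fun j : {j : ι // j ≠ i} => g j) (u i j) = g j := by
    intro i
    have hne : ∀ j, j ≠ i → FreeGroup.lift (fun j : {j : ι // j ≠ i} => g j) (u i j) = g j := by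
      intro j hj
      rw [hu i j hj]
      exact FreeGroup.lift_apply_of ..
    intro j
    by_cases hj : j = i
    · subst hj
      refine eq_of_prod_map_eq_one
        (u := fun m => FreeGroup.lift (fun m : {m : ι // m ≠ j} => g m) (u j m)) hl (hmem j) ?_
        hprod hne
      have := congrArg (FreeGroup.lift (fun m : {m : ι // m ≠ j} => g m)) (hu' j)
      rwa [map_list_prod, List.map_map, map_one] at this
    · exact hne j hj
  have hαα : ∀ i k, (α k i).comp (α i k) = MonoidHom.id _ := by
    intro i k
    ext j
    change α k i (α i k (FreeGroup.of j)) = FreeGroup.of j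
    rw [← hu i j j.2, hα, hα]
  have hcomp : (FreeGroup.lift (fun j : {j : ι // j ≠ k} => g j)).comp (α i k) =
      FreeGroup.lift (fun j : {j : ι // j ≠ i} => g j) := by
    ext j
    change FreeGroup.lift _ (α i k (FreeGroup.of j)) = _
    rw [← hu i j j.2, hα, hlift, hlift]
  have hinj : Function.Injective (α i k) :=
    Function.LeftInverse.injective (DFunLike.congr_fun (hαα i k))
  have hsurj : Function.Surjective (α i k) :=
    Function.RightInverse.surjective (DFunLike.congr_fun (hαα k i))
  refine ⟨?_, ?_⟩
  · rw [← hcomp]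
    exact hk.1.comp hinj
  · rw [← hcomp, MonoidHom.range_comp, MonoidHom.range_eq_top.mpr hsurj, ← MonoidHom.range_eq_map]
    exact hk.2

omit [DecidableEq ι] in
theorem FreelyGenerates.comp_equiv {ι' G : Type*} [Group G] {g : ι → G} {K : Subgroup G}
    (h : FreelyGenerates g K) (e : ι' ≃ ι) : FreelyGenerates (g ∘ e) K := by
  have hcomp : FreeGroup.lift (g ∘ e) =
      (FreeGroup.lift g).comp (FreeGroup.freeGroupCongr e).toMonoidHom := by
    ext j
    simp
  refine ⟨?_, ?_⟩
  · rw [hcomp]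
    exact h.1.comp (FreeGroup.freeGroupCongr e).injective
  · have hsurj := MonoidHom.range_eq_top_of_surjective (FreeGroup.freeGroupCongr e).toMonoidHom
      (FreeGroup.freeGroupCongr e).surjective
    rw [hcomp, MonoidHom.range_comp, hsurj, ← MonoidHom.range_eq_map]
    exact h.2

omit [DecidableEq ι] in
/-- A subgroup is isomorphic to the free group on a family that freely generates it. -/
theorem FreelyGenerates.nonempty_mulEquiv {G : Type*} [Group G] {g : ι → G} {K : Subgroup G}
    (h : FreelyGenerates g K) : Nonempty (K ≃* FreeGroup ι) :=
  ⟨((MonoidHom.ofInjective h.1).trans (MulEquiv.subgroupCongr h.2)).symm⟩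

end OmitOne

end TorusTwists

/-! ### Coset tables and the action they define -/

namespace TorusTwists

open Subgroup

section Quad

/-- The entries of a two by two integral matrix, for fast kernel evaluation. -/
abbrev Quad : Type := ℤ × ℤ × ℤ × ℤ

namespace Quad

def mul (x y : Quad) : Quad :=
  (x.1 * y.1 + x.2.1 * y.2.2.1, x.1 * y.2.1 + x.2.1 * y.2.2.2,
    x.2.2.1 * y.1 + x.2.2.2 * y.2.2.1, x.2.2.1 * y.2.1 + x.2.2.2 * y.2.2.2)

def neg (x : Quad) : Quad := (-x.1, -x.2.1, -x.2.2.1, -x.2.2.2)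

def inv (x : Quad) : Quad := (x.2.2.2, -x.2.1, -x.2.2.1, x.1)

def det (x : Quad) : ℤ := x.1 * x.2.2.2 - x.2.1 * x.2.2.1

def S : Quad := (0, -1, 1, 0)

def U : Quad := (1, -1, 1, 0)

/-- The entries of the `s`-th power of the Dehn twist along `v`. -/
def twist (s : ℤ) (v : ℤ × ℤ) : Quad :=
  (1 - s * (v.1 * v.2), s * v.1 ^ 2, -(s * v.2 ^ 2), 1 + s * (v.1 * v.2))

/-- Congruence modulo `s` of matrices. -/
def CongMod (s : ℤ) (x y : Quad) : Prop :=
  s ∣ x.1 - y.1 ∧ s ∣ x.2.1 - y.2.1 ∧ s ∣ x.2.2.1 - y.2.2.1 ∧ s ∣ x.2.2.2 - y.2.2.2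

instance (s : ℤ) (x y : Quad) : Decidable (CongMod s x y) := inferInstanceAs (Decidable (_ ∧ _))

end Quad

def toQuad (g : SL(2, ℤ)) : Quad := (g 0 0, g 0 1, g 1 0, g 1 1)

def ofQuad (x : Quad) (hx : x.det = 1) : SL(2, ℤ) :=
  ⟨!![x.1, x.2.1; x.2.2.1, x.2.2.2], by rw [Matrix.det_fin_two_of]; exact hx⟩

theorem toQuad_ofQuad (x : Quad) (hx : x.det = 1) : toQuad (ofQuad x hx) = x := rfl

theorem toQuad_injective : Function.Injective toQuad := by
  intro g h hgh
  simp only [toQuad, Prod.mk.injEq] at hgh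
  ext i j
  fin_cases i <;> fin_cases j
  exacts [hgh.1, hgh.2.1, hgh.2.2.1, hgh.2.2.2]

theorem toQuad_mul (g h : SL(2, ℤ)) : toQuad (g * h) = (toQuad g).mul (toQuad h) := by
  simp [toQuad, Quad.mul, Matrix.mul_apply, Fin.sum_univ_two]

theorem toQuad_neg (g : SL(2, ℤ)) : toQuad (-g) = (toQuad g).neg := by
  simp [toQuad, Quad.neg]

theorem toQuad_inv (g : SL(2, ℤ)) : toQuad g⁻¹ = (toQuad g).inv := by
  rw [Matrix.SpecialLinearGroup.SL2_inv_expl]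
  rfl

theorem toQuad_one : toQuad 1 = (1, 0, 0, 1) := rfl

theorem toQuad_S : toQuad ModularGroup.S = Quad.S := rfl

theorem toQuad_modU : toQuad modU = Quad.U := by
  rw [modU, toQuad_mul]; rfl

theorem toQuad_dehnTwist_pow (s : ℕ) (v : ℤ × ℤ) :
    toQuad (dehnTwist ![v.1, v.2] ^ s) = Quad.twist s v := by
  rw [toQuad, dehnTwist_pow]
  rfl

theorem toPSL_eq_of_toQuad_eq {g h : SL(2, ℤ)}
    (hgh : toQuad g = toQuad h ∨ toQuad g = (toQuad h).neg) : toPSL g = toPSL h := by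
  rcases hgh with hgh | hgh
  · rw [toQuad_injective hgh]
  · rw [← toQuad_neg] at hgh
    rw [toQuad_injective hgh]
    exact Subtype.ext (modularAction_neg h)

theorem congMod_toQuad_of_inv_mul_mem_Gamma {s : ℕ} {g h : SL(2, ℤ)}
    (hgh : g⁻¹ * h ∈ CongruenceSubgroup.Gamma s) : Quad.CongMod s (toQuad h) (toQuad g) := by
  rw [CongruenceSubgroup.Gamma_mem', map_mul, map_inv, inv_mul_eq_one] at hgh
  have key : ∀ i j, (s : ℤ) ∣ h i j - g i j := by
    intro i j
    rw [← ZMod.intCast_eq_intCast_iff_dvd_sub]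
    have := congrArg (fun x : SL(2, ZMod s) => x i j) hgh
    simpa using this
  exact ⟨key 0 0, key 0 1, key 1 0, key 1 1⟩

end Quad

/-- The states of a coset table: the `k`-th orbit of `modU` and a position in it. -/
abbrev State (m : ℕ) : Type := Fin m × Fin 3

/-- A table of the cosets of `± Γ_s`, the action of the generators of `SL(2, ℤ)` on them, and the
associated Schreier cocycle with values in the free group on `n` powers of Dehn twists. -/
structure CosetTable (s m n : ℕ) where
  /-- The vectors of the Dehn twists. -/
  vec : Fin n → ℤ × ℤ
  /-- The representatives of the orbits of `modU` on the cosets. -/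
  rep : Fin m → Quad
  /-- The action of `S` on the cosets. -/
  target : Fin m → Fin 3 → State m
  /-- The cocycle on `S`. -/
  label : Fin m → Fin 3 → List (Fin n × Bool)
  /-- Words in `S` (`true`) and `modU` (`false`) for the powers of the Dehn twists. -/
  word : Fin n → List Bool

namespace CosetTable

variable {s m n : ℕ}

section Evaluation

variable (T : CosetTable s m n)

/-- The representative of a coset. -/
def stateRep (q : State m) : Quad :=
  if q.2 = 0 then T.rep q.1 else
    if q.2 = 1 then Quad.U.mul (T.rep q.1) else Quad.U.mul (Quad.U.mul (T.rep q.1))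

/-- The matrix of a word in the powers of the Dehn twists. -/
def evalLabel : List (Fin n × Bool) → Quad
  | [] => (1, 0, 0, 1)
  | (j, b) :: l => (bif b then Quad.twist s (T.vec j) else (Quad.twist s (T.vec j)).inv).mul
      (evalLabel l)

/-- The matrix of a word in `S` and `modU`. -/
def evalWord : List Bool → Quad
  | [] => (1, 0, 0, 1)
  | b :: l => (bif b then Quad.S else Quad.U).mul (evalWord l)

/-- The action of a word in `S` and `modU` on a state and the value of the cocycle. -/
def run : List Bool → State m × List (Fin n × Bool) → State m × List (Fin n × Bool)
  | [], x => x
  | b :: l, x =>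
    let y := run l x
    bif b then (T.target y.1.1 y.1.2, T.label y.1.1 y.1.2 ++ y.2) else ((y.1.1, y.1.2 + 1), y.2)

end Evaluation

/-- The conditions that make a table a coset table; all of them can be decided. -/
structure IsValid (T : CosetTable s m n) (k₀ : Fin m) : Prop where
  primitive : ∀ j, Int.gcd (T.vec j).1 (T.vec j).2 = 1
  det_rep : ∀ k, (T.rep k).det = 1
  rep_zero : T.rep k₀ = (1, 0, 0, 1)
  target_target : ∀ k j, T.target (T.target k j).1 (T.target k j).2 = (k, j)
  label_target : ∀ k j, T.label (T.target k j).1 (T.target k j).2 = FreeGroup.invRev (T.label k j)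
  S_mul : ∀ k j, Quad.S.mul (T.stateRep (k, j)) =
      (T.stateRep (T.target k j)).mul (T.evalLabel (T.label k j)) ∨
    Quad.S.mul (T.stateRep (k, j)) =
      ((T.stateRep (T.target k j)).mul (T.evalLabel (T.label k j))).neg
  eval_word : ∀ j, evalWord (T.word j) = Quad.twist s (T.vec j) ∨
    evalWord (T.word j) = (Quad.twist s (T.vec j)).neg
  run_word : ∀ j, (T.run (T.word j) ((k₀, 0), [])).1 = (k₀, 0) ∧
    FreeGroup.reduce (T.run (T.word j) ((k₀, 0), [])).2 = [(j, true)]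
  distinct : ∀ k j k' j', (Quad.CongMod s (T.stateRep (k, j)) (T.stateRep (k', j')) ∨
    Quad.CongMod s (T.stateRep (k, j)) (T.stateRep (k', j')).neg) → (k, j) = (k', j')

variable (T : CosetTable s m n)

/-- The power of a Dehn twist belonging to a generator. -/
def twist (j : Fin n) : SL(2, ℤ) := dehnTwist ![(T.vec j).1, (T.vec j).2] ^ s

theorem toQuad_lift_mk (l : List (Fin n × Bool)) :
    toQuad (FreeGroup.lift T.twist (FreeGroup.mk l)) = T.evalLabel l := by
  induction l with
  | nil => rfl
  | cons a l ih =>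
    obtain ⟨j, b⟩ := a
    have h1 : FreeGroup.mk ((j, b) :: l) = FreeGroup.mk [(j, b)] * FreeGroup.mk l := by
      rw [FreeGroup.mul_mk]; rfl
    rw [h1, map_mul, toQuad_mul, ih, evalLabel]
    congr 1
    cases b
    · simp [FreeGroup.lift_mk, toQuad_inv, twist, toQuad_dehnTwist_pow]
    · simp [FreeGroup.lift_mk, twist, toQuad_dehnTwist_pow]

/-- The element of `SL(2, ℤ)` spelled by a word in `S` and `modU`. -/
def spell (l : List Bool) : SL(2, ℤ) :=
  (l.map fun b => bif b then ModularGroup.S else modU).prod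

theorem toQuad_spell (l : List Bool) : toQuad (spell l) = evalWord l := by
  induction l with
  | nil => rfl
  | cons b l ih =>
    rw [spell, List.map_cons, List.prod_cons, toQuad_mul]
    change Quad.mul _ (toQuad (spell l)) = _
    rw [ih, evalWord]
    cases b
    · rw [cond_false, cond_false, toQuad_modU]
    · rw [cond_true, cond_true, toQuad_S]

namespace IsValid

variable {T} {k₀ : Fin m} (hT : T.IsValid k₀)
include hT

theorem exists_repSL : ∃ R : State m → SL(2, ℤ), (∀ q, toQuad (R q) = T.stateRep q) ∧
    R (k₀, 0) = 1 ∧ ∀ k j, toPSL (modU * R (k, j)) = toPSL (R (k, j + 1)) := by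
  let r : Fin m → SL(2, ℤ) := fun k => ofQuad (T.rep k) (hT.det_rep k)
  refine ⟨fun q => modU ^ (q.2 : ℕ) * r q.1, ?_, ?_, ?_⟩
  · rintro ⟨k, j⟩
    fin_cases j
    · simp [stateRep, r, toQuad_ofQuad]
    · simp [stateRep, r, toQuad_mul, toQuad_modU, toQuad_ofQuad]
    · simp [stateRep, sq, mul_assoc, r, toQuad_mul, toQuad_modU, toQuad_ofQuad]
  · apply toQuad_injective
    simp [r, toQuad_ofQuad, hT.rep_zero, toQuad_one]
  · intro k j
    -- The position wraps around after three steps, where `modU ^ 3 = -1` disappears in `PSL(2, ℤ)`.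
    have hj : ((j + 1 : Fin 3) : ℕ) = j + 1 ∨ (j : ℕ) = 2 ∧ ((j + 1 : Fin 3) : ℕ) = 0 := by
      revert j; decide
    have h3 : toPSL (modU ^ 3) = 1 := Subtype.ext (by
      rw [modU_cube]; exact modularAction_neg_one)
    dsimp only
    rw [← mul_assoc, ← pow_succ']
    rcases hj with hj | ⟨hj, hj'⟩
    · rw [hj]
    · rw [hj, hj', map_mul, h3, pow_zero, one_mul, one_mul]

/-- The action of `SL(2, ℤ)` on the product of the cosets and the free group. -/
theorem exists_action : ∃ Φ : SL(2, ℤ) →* Equiv.Perm (State m × FreeGroup (Fin n)),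
    (∀ k j x, Φ ModularGroup.S ((k, j), x) = (T.target k j, FreeGroup.mk (T.label k j) * x)) ∧
    (∀ k j x, Φ modU ((k, j), x) = ((k, j + 1), x)) := by
  let f : State m × FreeGroup (Fin n) → State m × FreeGroup (Fin n) := fun y =>
    (T.target y.1.1 y.1.2, FreeGroup.mk (T.label y.1.1 y.1.2) * y.2)
  have hf : Function.Involutive f := by
    rintro ⟨⟨k, j⟩, x⟩
    simp only [f, hT.target_target, hT.label_target, ← FreeGroup.inv_mk, inv_mul_cancel_left]
  let g : Equiv.Perm (State m × FreeGroup (Fin n)) :=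
    ((Equiv.refl (Fin m)).prodCongr (Equiv.addRight (1 : Fin 3))).prodCongr (Equiv.refl _)
  obtain ⟨Φ, h1, h2⟩ := exists_modular_lift hf.toPerm g
    (by ext1 y; exact hf y)
    (by
      ext1 ⟨⟨k, j⟩, x⟩
      change ((k, j + 1 + 1 + 1), x) = ((k, j), x)
      congr 2
      fin_cases j <;> rfl)
  exact ⟨Φ, fun k j x => by rw [h1]; rfl, fun k j x => by rw [h2]; rfl⟩

/-- Up to sign, a pair (state, word) stands for the matrix representative times word, and the action
is left multiplication. It suffices to check this on `S` and `modU`. -/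
theorem toPSL_mul_rep {R : State m → SL(2, ℤ)} (hR : ∀ q, toQuad (R q) = T.stateRep q)
    (hRU : ∀ k j, toPSL (modU * R (k, j)) = toPSL (R (k, j + 1)))
    {Φ : SL(2, ℤ) →* Equiv.Perm (State m × FreeGroup (Fin n))}
    (hS : ∀ k j x, Φ ModularGroup.S ((k, j), x) =
      (T.target k j, FreeGroup.mk (T.label k j) * x))
    (hU : ∀ k j x, Φ modU ((k, j), x) = ((k, j + 1), x)) (g : SL(2, ℤ)) :
    ∀ y, toPSL (g * (R y.1 * FreeGroup.lift T.twist y.2)) =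
      toPSL (R (Φ g y).1 * FreeGroup.lift T.twist (Φ g y).2) := by
  have hg : g ∈ Subgroup.closure {ModularGroup.S, modU} := by rw [closure_S_modU]; trivial
  induction hg using Subgroup.closure_induction with
  | mem g hg =>
    rintro ⟨⟨k, j⟩, x⟩
    rcases hg with rfl | rfl
    · have h : toPSL (ModularGroup.S * R (k, j)) =
          toPSL (R (T.target k j) * FreeGroup.lift T.twist (FreeGroup.mk (T.label k j))) := by
        apply toPSL_eq_of_toQuad_eq
        rw [toQuad_mul, toQuad_mul, hR, hR, toQuad_S, toQuad_lift_mk]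
        exact hT.S_mul k j
      rw [hS]
      dsimp only
      rw [map_mul (FreeGroup.lift T.twist), ← mul_assoc, ← mul_assoc,
        map_mul toPSL (ModularGroup.S * _), h, ← map_mul]
    · rw [hU, ← mul_assoc, map_mul, hRU, map_mul]
  | one => intro y; simp
  | mul a b _ _ ha hb =>
    intro y
    rw [mul_assoc, map_mul, hb, ← map_mul, ha, map_mul Φ, Equiv.Perm.mul_apply]
  | inv a _ ha =>
    intro y
    have := ha (Φ a⁻¹ y)
    rw [← Equiv.Perm.mul_apply, ← map_mul, mul_inv_cancel, map_one, Equiv.Perm.one_apply] at this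
    rw [map_mul toPSL, ← this, ← map_mul, inv_mul_cancel_left]

omit hT in
theorem action_mul_right {Φ : SL(2, ℤ) →* Equiv.Perm (State m × FreeGroup (Fin n))}
    (hS : ∀ k j x, Φ ModularGroup.S ((k, j), x) =
      (T.target k j, FreeGroup.mk (T.label k j) * x))
    (hU : ∀ k j x, Φ modU ((k, j), x) = ((k, j + 1), x)) (g : SL(2, ℤ)) :
    ∀ q x z, Φ g (q, x * z) = ((Φ g (q, x)).1, (Φ g (q, x)).2 * z) := by
  have hg : g ∈ Subgroup.closure {ModularGroup.S, modU} := by rw [closure_S_modU]; trivial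
  induction hg using Subgroup.closure_induction with
  | mem g hg =>
    rintro ⟨k, j⟩ x z
    rcases hg with rfl | rfl
    · rw [hS, hS, mul_assoc]
    · rw [hU, hU]
  | one => intro q x z; simp
  | mul a b _ _ ha hb =>
    intro q x z
    rw [map_mul, Equiv.Perm.mul_apply, Equiv.Perm.mul_apply, hb, ha]
  | inv a _ ha =>
    intro q x z
    rw [map_inv, Equiv.Perm.inv_eq_iff_eq, ha, Prod.mk.eta, ← Equiv.Perm.mul_apply,
      mul_inv_cancel, Equiv.Perm.one_apply]

omit hT in
theorem action_spell {Φ : SL(2, ℤ) →* Equiv.Perm (State m × FreeGroup (Fin n))}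
    (hS : ∀ k j x, Φ ModularGroup.S ((k, j), x) =
      (T.target k j, FreeGroup.mk (T.label k j) * x))
    (hU : ∀ k j x, Φ modU ((k, j), x) = ((k, j + 1), x)) (l : List Bool) (q : State m)
    (w : List (Fin n × Bool)) :
    Φ (spell l) (q, FreeGroup.mk w) =
      ((T.run l (q, w)).1, FreeGroup.mk (T.run l (q, w)).2) := by
  induction l with
  | nil => simp [spell, run]
  | cons b l ih =>
    rw [spell, List.map_cons, List.prod_cons, map_mul, Equiv.Perm.mul_apply]
    change Φ _ (Φ (spell l) _) = _
    rw [ih, run]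
    obtain ⟨⟨⟨k, j⟩, w'⟩, hy⟩ : ∃ y, y = T.run l (q, w) := ⟨_, rfl⟩
    rw [← hy]
    cases b
    · exact hU k j _
    · simp only [cond_true]
      rw [hS, FreeGroup.mul_mk]

theorem toPSL_twist (j : Fin n) : toPSL (T.twist j) = toPSL (spell (T.word j)) := by
  apply Eq.symm
  apply toPSL_eq_of_toQuad_eq
  rw [toQuad_spell, twist, toQuad_dehnTwist_pow]
  exact hT.eval_word j

/-- The chosen powers of Dehn twists generate a free group, even modulo `± 1`. -/
theorem eq_one_of_toPSL_lift_eq_one {x : FreeGroup (Fin n)}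
    (hx : toPSL (FreeGroup.lift T.twist x) = 1) : x = 1 := by
  obtain ⟨Φ, hS, hU⟩ := hT.exists_action
  have hneg : Φ (-1) = 1 := by
    rw [← S_sq, map_pow, sq]
    ext1 ⟨⟨k, j⟩, x⟩
    rw [Equiv.Perm.mul_apply, hS, hS, hT.label_target, ← FreeGroup.inv_mk, inv_mul_cancel_left]
    simp only [hT.target_target, Equiv.Perm.one_apply]
  have hΦ : ∀ g h : SL(2, ℤ), toPSL g = toPSL h → Φ g = Φ h := by
    intro g h hgh
    rcases eq_or_eq_neg_of_toPSL_eq hgh with rfl | rfl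
    · rfl
    · rw [← neg_one_mul, map_mul, hneg, one_mul]
  have hgen : ∀ j z, Φ (T.twist j) ((k₀, 0), z) = ((k₀, 0), FreeGroup.of j * z) := by
    intro j z
    have h1 := action_mul_right hS hU (T.twist j) (k₀, 0) 1 z
    rw [one_mul] at h1
    rw [h1, hΦ _ _ (hT.toPSL_twist j), FreeGroup.one_eq_mk, action_spell hS hU,
      (hT.run_word j).1, ← FreeGroup.reduce.self, (hT.run_word j).2]
    rfl
  -- On the fibre over the base state the subgroup acts by left translations of the free group,
  -- which are faithful.
  have key : ∀ x z, Φ (FreeGroup.lift T.twist x) ((k₀, 0), z) = ((k₀, 0), x * z) := by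
    intro x
    induction x using FreeGroup.induction_on with
    | C1 => intro z; simp
    | of j => intro z; rw [FreeGroup.lift_apply_of, hgen]
    | inv_of j _ =>
      intro z
      rw [map_inv, map_inv, Equiv.Perm.inv_eq_iff_eq, FreeGroup.lift_apply_of, hgen,
        mul_inv_cancel_left]
    | mul x y hx hy =>
      intro z
      rw [map_mul, map_mul, Equiv.Perm.mul_apply, hy, hx, mul_assoc]
  have h1 := key x 1
  rw [hΦ _ 1 (hx.trans (map_one _).symm), map_one, Equiv.Perm.one_apply, mul_one] at h1
  exact (congrArg Prod.snd h1).symm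

theorem lift_twist_mem_N (x : FreeGroup (Fin n)) : FreeGroup.lift T.twist x ∈ N s := by
  have h : (FreeGroup.lift T.twist).range ≤ N s := by
    rw [FreeGroup.range_lift_eq_closure, closure_le]
    rintro _ ⟨j, rfl⟩
    exact Subgroup.subset_closure ⟨![(T.vec j).1, (T.vec j).2], hT.primitive j, rfl⟩
  exact h ⟨x, rfl⟩

/-- The representatives of a coset table are a transversal modulo `± Γ_s`. -/
theorem exists_transversal : ∃ R : State m → SL(2, ℤ), R (k₀, 0) = 1 ∧
    (∀ q q', ((R q)⁻¹ * R q' ∈ CongruenceSubgroup.Gamma s ∨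
      -((R q)⁻¹ * R q') ∈ CongruenceSubgroup.Gamma s) → q = q') ∧
    ∀ g, ∃ q x, toPSL g = toPSL (R q * FreeGroup.lift T.twist x) := by
  obtain ⟨R, hR, hR₀, hRU⟩ := hT.exists_repSL
  obtain ⟨Φ, hS, hU⟩ := hT.exists_action
  refine ⟨R, hR₀, fun q q' h => ?_, fun g =>
    ⟨(Φ g ((k₀, 0), 1)).1, (Φ g ((k₀, 0), 1)).2, ?_⟩⟩
  · rw [← mul_neg] at h
    refine (hT.distinct q'.1 q'.2 q.1 q.2 ?_).symm
    rcases h with h | h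
    · left
      have := congMod_toQuad_of_inv_mul_mem_Gamma h
      rwa [hR, hR] at this
    · right
      have h' : (-R q)⁻¹ * R q' ∈ CongruenceSubgroup.Gamma s := by
        rwa [inv_neg, neg_mul_comm]
      have := congMod_toQuad_of_inv_mul_mem_Gamma h'
      rwa [toQuad_neg, hR, hR] at this
  · have := hT.toPSL_mul_rep hR hRU hS hU g ((k₀, 0), 1)
    rw [map_one, hR₀, mul_one, mul_one] at this
    exact this

/-- The word part lies in `Γ_s`, so the representative of `g` lies in `± Γ_s` and must be that of
the base state. -/
theorem exists_eq_lift_of_mem_Gamma {g : SL(2, ℤ)} (hg : g ∈ CongruenceSubgroup.Gamma s) :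
    ∃ x, g = FreeGroup.lift T.twist x ∨ g = -FreeGroup.lift T.twist x := by
  obtain ⟨R, hR₀, hR, hcover⟩ := hT.exists_transversal
  obtain ⟨q, x, hx⟩ := hcover g
  have hmem := N_le_Gamma s (hT.lift_twist_mem_N x)
  have hq : (k₀, 0) = q := by
    apply hR
    rw [hR₀, inv_one, one_mul]
    rcases eq_or_eq_neg_of_toPSL_eq hx with rfl | rfl
    · exact Or.inl ((mul_mem_cancel_right hmem).mp hg)
    · rw [← neg_mul] at hg
      exact Or.inr ((mul_mem_cancel_right hmem).mp hg)
  rw [← hq, hR₀, one_mul] at hx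
  exact ⟨x, eq_or_eq_neg_of_toPSL_eq hx⟩

theorem freelyGenerates_Gamma (hs : 3 ≤ s) :
    FreelyGenerates T.twist (CongruenceSubgroup.Gamma s) := by
  refine ⟨?_, le_antisymm ?_ fun g hg => ?_⟩
  · rw [injective_iff_map_eq_one]
    intro x hx
    exact hT.eq_one_of_toPSL_lift_eq_one (by rw [hx, map_one])
  · rintro _ ⟨x, rfl⟩
    exact N_le_Gamma s (hT.lift_twist_mem_N x)
  · obtain ⟨x, hx | hx⟩ := hT.exists_eq_lift_of_mem_Gamma hg
    · exact ⟨x, hx.symm⟩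
    · refine absurd ?_ (neg_one_notMem_Gamma hs)
      have hmem := N_le_Gamma s (hT.lift_twist_mem_N x)
      rw [hx, ← neg_one_mul] at hg
      exact (mul_mem_cancel_right hmem).mp hg

theorem N_eq_Gamma (hs : 3 ≤ s) : N s = CongruenceSubgroup.Gamma s := by
  refine le_antisymm (N_le_Gamma s) ?_
  rw [← (hT.freelyGenerates_Gamma hs).2]
  rintro _ ⟨x, rfl⟩
  exact hT.lift_twist_mem_N x

/-- There are `m * 3` cosets of `± Γ_s`, and each splits in two because `-1` is not in `Γ_s`. -/
theorem index_Gamma (hs : 3 ≤ s) : (CongruenceSubgroup.Gamma s).index = m * 3 * 2 := by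
  obtain ⟨R, hR₀, hR, hcover⟩ := hT.exists_transversal
  have hneg := neg_one_notMem_Gamma hs
  let f : State m × Bool → SL(2, ℤ) ⧸ CongruenceSubgroup.Gamma s := fun y =>
    ((bif y.2 then R y.1 else -R y.1 : SL(2, ℤ)) : SL(2, ℤ) ⧸ CongruenceSubgroup.Gamma s)
  have hf : Function.Bijective f := by
    constructor
    · rintro ⟨q, b⟩ ⟨q', b'⟩ h
      have h1 := QuotientGroup.eq.mp h
      have hq : q = q' := by
        apply hR
        cases b <;> cases b' <;>
          simp only [cond_true, cond_false, inv_neg, neg_mul, mul_neg, neg_neg] at h1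
        exacts [Or.inl h1, Or.inr h1, Or.inr h1, Or.inl h1]
      subst hq
      cases b <;> cases b' <;>
        simp only [cond_true, cond_false, inv_neg, neg_mul, mul_neg, inv_mul_cancel] at h1
      · rfl
      · exact absurd h1 hneg
      · exact absurd h1 hneg
      · rfl
    · intro y
      induction y using QuotientGroup.induction_on with
      | H g =>
        obtain ⟨q, x, hx⟩ := hcover g
        have hmem := N_le_Gamma s (hT.lift_twist_mem_N x)
        rcases eq_or_eq_neg_of_toPSL_eq hx with rfl | rfl
        · exact ⟨(q, true), QuotientGroup.eq.mpr (by simpa using hmem)⟩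
        · exact ⟨(q, false), QuotientGroup.eq.mpr (by simpa using hmem)⟩
  rw [Subgroup.index, ← Nat.card_congr (Equiv.ofBijective f hf)]
  simp

theorem index_Gamma_of_neg_one_mem (hneg : (-1 : SL(2, ℤ)) ∈ CongruenceSubgroup.Gamma s) :
    (CongruenceSubgroup.Gamma s).index = m * 3 := by
  obtain ⟨R, hR₀, hR, hcover⟩ := hT.exists_transversal
  let f : State m → SL(2, ℤ) ⧸ CongruenceSubgroup.Gamma s := fun q => (R q : SL(2, ℤ) ⧸ _)
  have hf : Function.Bijective f := by
    constructor
    · intro q q' h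
      exact hR q q' (Or.inl (QuotientGroup.eq.mp h))
    · intro y
      induction y using QuotientGroup.induction_on with
      | H g =>
        obtain ⟨q, x, hx⟩ := hcover g
        have hmem := N_le_Gamma s (hT.lift_twist_mem_N x)
        refine ⟨q, QuotientGroup.eq.mpr ?_⟩
        rcases eq_or_eq_neg_of_toPSL_eq hx with rfl | rfl
        · simpa using hmem
        · simpa using mul_mem hneg hmem
  rw [Subgroup.index, ← Nat.card_congr (Equiv.ofBijective f hf)]
  simp

theorem N_eq_Gamma_of_neg_one_mem (hneg : (-1 : SL(2, ℤ)) ∈ N s) :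
    N s = CongruenceSubgroup.Gamma s := by
  refine le_antisymm (N_le_Gamma s) fun g hg => ?_
  obtain ⟨x, rfl | rfl⟩ := hT.exists_eq_lift_of_mem_Gamma hg
  · exact hT.lift_twist_mem_N x
  · rw [← neg_one_mul]
    exact mul_mem hneg (hT.lift_twist_mem_N x)

theorem nonempty_N_mulEquiv_prod (hneg : (-1 : SL(2, ℤ)) ∈ N s) :
    Nonempty (N s ≃* FreeGroup (Fin n) × Multiplicative (ZMod 2)) := by
  let ψ : Multiplicative (ZMod 2) →* SL(2, ℤ) := powHom 2 (-1) (neg_one_sq)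
  have hψ : ∀ y, ψ y = 1 ∧ y = 1 ∨ ψ y = -1 := by
    have h2 : ∀ y : Multiplicative (ZMod 2), y = 1 ∨ y = Multiplicative.ofAdd 1 := by decide
    intro y
    rcases h2 y with rfl | rfl
    · exact Or.inl ⟨map_one _, rfl⟩
    · exact Or.inr (powHom_one _ _ _)
  have hψPSL : ∀ y, toPSL (ψ y) = 1 := by
    intro y
    rcases hψ y with h | h
    · rw [h.1, map_one]
    · rw [h]
      exact Subtype.ext modularAction_neg_one
  let f : FreeGroup (Fin n) × Multiplicative (ZMod 2) →* SL(2, ℤ) :=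
    MonoidHom.noncommCoprod (FreeGroup.lift T.twist) ψ (by
      intro x y
      rcases hψ y with h | h
      · rw [h.1]
        exact Commute.one_right _
      · rw [h]
        exact Commute.neg_one_right _)
  have hf : ∀ x y, f (x, y) = FreeGroup.lift T.twist x * ψ y := fun x y => rfl
  have hinj : Function.Injective f := by
    rw [injective_iff_map_eq_one]
    rintro ⟨x, y⟩ h
    rw [hf] at h
    have hx : x = 1 := by
      apply hT.eq_one_of_toPSL_lift_eq_one
      have := congrArg toPSL h
      rwa [map_mul, hψPSL, mul_one, map_one] at this
    subst hx
    rw [map_one, one_mul] at h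
    rcases hψ y with h' | h'
    · rw [h'.2]; rfl
    · rw [h] at h'
      exact absurd h' (by decide)
  have hrange : f.range = N s := by
    refine le_antisymm ?_ fun g hg => ?_
    · rintro _ ⟨⟨x, y⟩, rfl⟩
      rw [hf]
      refine mul_mem (hT.lift_twist_mem_N x) ?_
      rcases hψ y with h | h
      · rw [h.1]
        exact one_mem _
      · rwa [h]
    · obtain ⟨x, rfl | rfl⟩ := hT.exists_eq_lift_of_mem_Gamma (N_le_Gamma s hg)
      · exact ⟨(x, 1), by rw [hf, map_one, mul_one]⟩
      · refine ⟨(x, Multiplicative.ofAdd 1), ?_⟩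
        rw [hf]
        simp only [ψ]
        rw [powHom_one, mul_neg_one]
  exact ⟨((MonoidHom.ofInjective hinj).trans (MulEquiv.subgroupCongr hrange)).symm⟩

/-- `k` is the position of the vector absent from the table, and `l` is an order in which all the
twist powers multiply to `1`. -/
theorem freelyGenerates_omit (hs : 3 ≤ s)
    {V : Fin (n + 1) → H1} {k : Fin (n + 1)}
    (hV : ∀ j, V (k.succAbove j) = ![(T.vec j).1, (T.vec j).2]) {l : List (Fin (n + 1))}
    (hl : l.Nodup) (hmem : ∀ i, i ∈ l)
    (hprod : l.foldr (fun j x => (Quad.twist s (V j 0, V j 1)).mul x) (1, 0, 0, 1) = (1, 0, 0, 1))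
    (i : Fin (n + 1)) :
    FreelyGenerates (fun j : {j : Fin (n + 1) // j ≠ i} => dehnTwist (V j) ^ s) (N s) := by
  have hquad : ∀ l : List (Fin (n + 1)), toQuad (l.map fun j => dehnTwist (V j) ^ s).prod =
      l.foldr (fun j x => (Quad.twist s (V j 0, V j 1)).mul x) (1, 0, 0, 1) := by
    intro l
    induction l with
    | nil => rfl
    | cons j l ih =>
      have hj : V j = ![V j 0, V j 1] := by
        funext a; fin_cases a <;> rfl
      rw [List.map_cons, List.prod_cons, toQuad_mul, ih, List.foldr_cons]
      nth_rewrite 1 [hj]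
      rw [toQuad_dehnTwist_pow s (V j 0, V j 1)]
  refine FreelyGenerates.omit_of_prod_eq_one (g := fun j => dehnTwist (V j) ^ s) hl hmem
    (toQuad_injective ((hquad l).trans hprod)) (k := k) ?_ i
  rw [hT.N_eq_Gamma hs]
  convert (hT.freelyGenerates_Gamma hs).comp_equiv (finSuccAboveEquiv k).symm using 1
  funext j
  obtain ⟨j, rfl⟩ := (finSuccAboveEquiv k).surjective j
  rw [Function.comp_apply, Equiv.symm_apply_apply, twist, ← hV]
  rfl

end IsValid

end CosetTable

end TorusTwists

/-! ### Explicit tables for levels 2 to 5 -/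

namespace TorusTwists

namespace CosetTable

/-- A coset table for level 2. -/
def tableTwo : CosetTable 2 2 2 where
  vec := ![
    (1, 0), (0, 1)]
  rep := ![
    (1, 0, 0, 1), (0, -1, 1, 0)]
  target := ![
    ![(1, 0), (1, 2), (1, 1)], ![(0, 0), (0, 2), (0, 1)]]
  label := ![
    ![[], [(1, true)], [(0, false)]], ![[], [(0, true)], [(1, false)]]]
  word := ![
    [false, true, false, true], [true, false, true, false]]

theorem tableTwo_isValid : tableTwo.IsValid 0 where
  primitive := by decide +kernel
  det_rep := by decide +kernel
  rep_zero := by decide +kernel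
  target_target := by decide +kernel
  label_target := by decide +kernel
  S_mul := by decide +kernel
  eval_word := by decide +kernel
  run_word := by decide +kernel
  distinct := by decide +kernel

/-- A coset table for level 3. -/
def tableThree : CosetTable 3 4 3 where
  vec := ![
    (1, 0), (0, 1), (1, 1)]
  rep := ![
    (1, 0, 0, 1), (0, -1, 1, 0), (-1, 0, 1, -1), (-1, 1, 0, -1)]
  target := ![
    ![(1, 0), (2, 0), (3, 0)], ![(0, 0), (3, 2), (2, 1)], ![(0, 1), (1, 2), (3, 1)],
    ![(0, 2), (2, 2), (1, 1)]]
  label := ![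
    ![[], [], []], ![[], [(0, true)], [(1, false)]], ![[], [(1, true)], [(2, false)]],
    ![[], [(2, true)], [(0, false)]]]
  word := ![
    [false, true, false, true, false, true], [true, false, true, false, true, false],
    [false, false, true, false, true, false, true, false, false]]

theorem tableThree_isValid : tableThree.IsValid 0 where
  primitive := by decide +kernel
  det_rep := by decide +kernel
  rep_zero := by decide +kernel
  target_target := by decide +kernel
  label_target := by decide +kernel
  S_mul := by decide +kernel
  eval_word := by decide +kernel
  run_word := by decide +kernel
  distinct := by decide +kernel

/-- A coset table for level 4. -/
def tableFour : CosetTable 4 8 5 where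
  vec := ![
    (1, 0), (0, 1), (1, 1), (1, -1), (1, 2)]
  rep := ![
    (1, 0, 0, 1), (0, -1, 1, 0), (1, 1, -1, 0), (-1, 0, 1, -1), (-1, 1, 0, -1), (0, 1, -1, -1),
    (-1, -1, 2, 1), (2, -1, -1, 1)]
  target := ![
    ![(1, 0), (3, 0), (4, 0)], ![(0, 0), (5, 0), (2, 0)], ![(1, 2), (6, 0), (3, 1)],
    ![(0, 1), (2, 2), (7, 0)], ![(0, 2), (7, 2), (5, 1)], ![(1, 1), (4, 2), (6, 1)],
    ![(2, 1), (5, 2), (7, 1)], ![(3, 2), (6, 2), (4, 1)]]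
  label := ![
    ![[], [], []], ![[], [], []], ![[], [], [(1, false)]], ![[], [(1, true)], []],
    ![[], [(2, true)], [(0, false)]], ![[], [(0, true)], [(3, false)]],
    ![[], [(3, true)], [(4, false), (1, false)]], ![[], [(1, true), (4, true)], [(2, false)]]]
  word := ![
    [false, true, false, true, false, true, false, true],
    [true, false, true, false, true, false, true, false],
    [false, false, true, false, true, false, true, false, true, false, false],
    [true, false, false, true, false, true, false, true, false, true, false, false, true],
    [false, false, true, false, false, true, false, true, false, true, false, true, false, false, true, false]]

theorem tableFour_isValid : tableFour.IsValid 0 where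
  primitive := by decide +kernel
  det_rep := by decide +kernel
  rep_zero := by decide +kernel
  target_target := by decide +kernel
  label_target := by decide +kernel
  S_mul := by decide +kernel
  eval_word := by decide +kernel
  run_word := by decide +kernel
  distinct := by decide +kernel

/-- A coset table for level 5. -/
def tableFive : CosetTable 5 20 11 where
  vec := ![
    (1, 0), (0, 1), (1, 1), (1, -1), (1, 2), (2, 1), (1, -2), (-2, 1), (2, 3), (2, 5), (5, 2)]
  rep := ![
    (1, 0, 0, 1), (0, -1, 1, 0), (-1, 1, 0, -1), (-1, 0, 1, -1), (0, 1, -1, -1), (1, 1, -1, 0),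
    (1, -1, -1, 2), (1, -2, 0, 1), (2, -1, -1, 1), (1, 0, -2, 1), (-1, 2, 1, -3), (-1, -2, 1, 1),
    (-2, 1, 3, -2), (-1, -1, 2, 1), (-2, 3, 1, -2), (-3, 1, 2, -1), (2, -3, -3, 5),
    (2, -5, -1, 3), (3, -1, -5, 2), (-5, 8, 3, -5)]
  target := ![
    ![(1, 0), (3, 0), (2, 0)], ![(0, 0), (4, 0), (5, 0)], ![(0, 2), (6, 0), (7, 0)],
    ![(0, 1), (9, 0), (8, 0)], ![(1, 1), (7, 2), (11, 0)], ![(1, 2), (13, 0), (9, 1)],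
    ![(2, 1), (8, 2), (14, 0)], ![(2, 2), (10, 0), (4, 1)], ![(3, 2), (12, 0), (6, 1)],
    ![(3, 1), (5, 2), (15, 0)], ![(7, 1), (14, 2), (17, 0)], ![(4, 2), (17, 2), (13, 1)],
    ![(8, 1), (15, 2), (16, 1)], ![(5, 1), (11, 2), (18, 1)], ![(6, 2), (16, 0), (10, 1)],
    ![(9, 2), (18, 0), (12, 1)], ![(14, 1), (12, 2), (19, 0)], ![(10, 2), (19, 2), (11, 1)],
    ![(15, 1), (13, 2), (19, 1)], ![(16, 2), (18, 2), (17, 1)]]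
  label := ![
    ![[], [], []], ![[], [], []], ![[], [], []], ![[], [], []], ![[], [(0, true)], []],
    ![[], [], [(1, false)]], ![[], [(2, true)], []], ![[], [], [(0, false)]],
    ![[], [], [(2, false)]], ![[], [(1, true)], []], ![[], [(5, true)], []],
    ![[], [(0, true), (7, true)], [(3, false)]], ![[], [(4, true)], [(2, false), (8, false)]],
    ![[], [(3, true)], [(1, false), (6, false)]], ![[], [], [(5, false)]],
    ![[], [], [(4, false)]], ![[], [(8, true), (2, true)], []],
    ![[], [(5, true), (10, true)], [(7, false), (0, false)]],
    ![[], [(6, true), (1, true)], [(2, false), (8, false), (4, false), (9, false)]],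
    ![[], [(9, true), (4, true), (8, true), (2, true)], [(10, false), (5, false)]]]
  word := ![
    [false, true, false, true, false, true, false, true, false, true],
    [true, false, true, false, true, false, true, false, true, false],
    [false, false, true, false, true, false, true, false, true, false, true, false, false],
    [true, false, false, true, false, true, false, true, false, true, false, true, false, false, true],
    [false, false, true, false, false, true, false, true, false, true, false, true, false, true, false, false, true, false],
    [false, true, false, false, true, false, true, false, true, false, true, false, true, false, false, true, false, false],
    [true, false, true, false, false, true, false, true, false, true, false, true, false, true, false, false, true, false, false, true],
    [true, false, false, true, false, false, true, false, true, false, true, false, true, false, true, false, false, true, false, true],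
    [false, false, true, false, true, false, false, true, false, true, false, true, false, true, false, true, false, false, true, false, false, true, false],
    [false, false, true, false, false, true, false, true, false, false, true, false, true, false, true, false, true, false, true, false, false, true, false, false, true, false, true, false],
    [false, true, false, true, false, false, true, false, false, true, false, true, false, true, false, true, false, true, false, false, true, false, true, false, false, true, false, false]]

theorem tableFive_isValid : tableFive.IsValid 0 where
  primitive := by decide +kernel
  det_rep := by decide +kernel
  rep_zero := by decide +kernel
  target_target := by decide +kernel
  label_target := by decide +kernel
  S_mul := by decide +kernel
  eval_word := by decide +kernel
  run_word := by decide +kernel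
  distinct := by decide +kernel

end CosetTable

end TorusTwists

/-! ### The groups `N s` for `s ≤ 5` and the final assembly -/

namespace TorusTwists

open CosetTable

theorem neg_one_mem_N_two : (-1 : SL(2, ℤ)) ∈ N 2 := by
  have hmem : ∀ v, IsPrimitive v → dehnTwist v ^ 2 ∈ N 2 := fun v hv =>
    Subgroup.subset_closure ⟨v, hv, rfl⟩
  have h : (-1 : SL(2, ℤ)) =
      dehnTwist ![0, 1] ^ 2 * dehnTwist ![1, 1] ^ 2 * dehnTwist ![1, 0] ^ 2 := by
    apply toQuad_injective
    rw [toQuad_mul, toQuad_mul, toQuad_dehnTwist_pow 2 (0, 1), toQuad_dehnTwist_pow 2 (1, 1),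
      toQuad_dehnTwist_pow 2 (1, 0)]
    decide
  rw [h]
  exact mul_mem (mul_mem (hmem _ (by simp [IsPrimitive])) (hmem _ (by simp [IsPrimitive])))
    (hmem _ (by simp [IsPrimitive]))

theorem freelyGenerates_N_three (i : Fin 4) : FreelyGenerates
    (fun j : {j : Fin 4 // j ≠ i} => dehnTwist (vectors3 j) ^ 3) (N 3) :=
  tableThree_isValid.freelyGenerates_omit le_rfl (k := 3) (by decide +kernel)
    (l := [0, 3, 1, 2]) (by decide) (by decide) (by decide +kernel) i

theorem freelyGenerates_N_four (i : Fin 6) : FreelyGenerates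
    (fun j : {j : Fin 6 // j ≠ i} => dehnTwist (vectors4 j) ^ 4) (N 4) :=
  tableFour_isValid.freelyGenerates_omit (by norm_num) (k := 5) (by decide +kernel)
    (l := [0, 3, 1, 4, 2, 5]) (by decide) (by decide) (by decide +kernel) i

theorem freelyGenerates_N_five (i : Fin 12) : FreelyGenerates
    (fun j : {j : Fin 12 // j ≠ i} => dehnTwist (vectors5 j) ^ 5) (N 5) :=
  tableFive_isValid.freelyGenerates_omit (by norm_num) (k := 9) (by decide +kernel)
    (l := [0, 7, 3, 9, 6, 1, 10, 4, 8, 2, 5, 11]) (by decide) (by decide) (by decide +kernel) i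

theorem N_eq_Gamma_of_le_five (s : ℕ) (h1 : 1 ≤ s) (h5 : s ≤ 5) :
    N s = CongruenceSubgroup.Gamma s := by
  interval_cases s
  · rw [N_one, CongruenceSubgroup.Gamma_one_top]
  · exact tableTwo_isValid.N_eq_Gamma_of_neg_one_mem neg_one_mem_N_two
  · exact tableThree_isValid.N_eq_Gamma le_rfl
  · exact tableFour_isValid.N_eq_Gamma (by norm_num)
  · exact tableFive_isValid.N_eq_Gamma (by norm_num)

end TorusTwists

theorem theorem1p3 :
    -- `s = 1`, `s = 2`: the isomorphism types
    TorusTwists.N 1 = ⊤ ∧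
    Nonempty (TorusTwists.N 2 ≃* FreeGroup (Fin 2) × Multiplicative (ZMod 2)) ∧
    -- `s = 3, 4, 5`: free of rank `3, 5, 11`
    Nonempty (TorusTwists.N 3 ≃* FreeGroup (Fin 3)) ∧
    Nonempty (TorusTwists.N 4 ≃* FreeGroup (Fin 5)) ∧
    Nonempty (TorusTwists.N 5 ≃* FreeGroup (Fin 11)) ∧
    -- for `1 ≤ s ≤ 5` it is the principal congruence subgroup
    (∀ s : ℕ, 1 ≤ s → s ≤ 5 → TorusTwists.N s = CongruenceSubgroup.Gamma s) ∧
    -- the indices in `SL(2, ℤ)`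
    ((TorusTwists.N 1).index = 1 ∧ (TorusTwists.N 2).index = 6 ∧ (TorusTwists.N 3).index = 24 ∧
      (TorusTwists.N 4).index = 48 ∧ (TorusTwists.N 5).index = 120) ∧
    -- explicit free generators: all but any one of the listed vectors
    (∀ i : Fin 4, TorusTwists.FreelyGenerates
      (fun j : {j : Fin 4 // j ≠ i} => TorusTwists.dehnTwist (TorusTwists.vectors3 j) ^ 3)
      (TorusTwists.N 3)) ∧
    (∀ i : Fin 6, TorusTwists.FreelyGenerates
      (fun j : {j : Fin 6 // j ≠ i} => TorusTwists.dehnTwist (TorusTwists.vectors4 j) ^ 4)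
      (TorusTwists.N 4)) ∧
    (∀ i : Fin 12, TorusTwists.FreelyGenerates
      (fun j : {j : Fin 12 // j ≠ i} => TorusTwists.dehnTwist (TorusTwists.vectors5 j) ^ 5)
      (TorusTwists.N 5)) ∧
    -- `s ≥ 6`: free of countably infinite rank, of infinite index in `Γ_s` and in `SL(2, ℤ)`
    (∀ s : ℕ, 6 ≤ s →
      Nonempty (TorusTwists.N s ≃* FreeGroup ℕ) ∧
      TorusTwists.N s ≤ CongruenceSubgroup.Gamma s ∧
      Infinite (CongruenceSubgroup.Gamma s ⧸
        (TorusTwists.N s).subgroupOf (CongruenceSubgroup.Gamma s)) ∧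
      Infinite (SL(2, ℤ) ⧸ TorusTwists.N s)) := by
  have hGamma := TorusTwists.N_eq_Gamma_of_le_five
  refine ⟨TorusTwists.N_one,
    TorusTwists.CosetTable.tableTwo_isValid.nonempty_N_mulEquiv_prod TorusTwists.neg_one_mem_N_two,
    ?_, ?_, ?_, hGamma, ⟨?_, ?_, ?_, ?_, ?_⟩, TorusTwists.freelyGenerates_N_three,
    TorusTwists.freelyGenerates_N_four, TorusTwists.freelyGenerates_N_five, fun s hs =>
    ⟨TorusTwists.nonempty_N_mulEquiv_freeGroup_nat hs, TorusTwists.N_le_Gamma s,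
      TorusTwists.infinite_Gamma_quotient_N hs, TorusTwists.infinite_quotient_N hs⟩⟩
  · rw [hGamma 3 (by norm_num) (by norm_num)]
    exact (TorusTwists.CosetTable.tableThree_isValid.freelyGenerates_Gamma le_rfl).nonempty_mulEquiv
  · rw [hGamma 4 (by norm_num) (by norm_num)]
    exact (TorusTwists.CosetTable.tableFour_isValid.freelyGenerates_Gamma
      (by norm_num)).nonempty_mulEquiv
  · rw [hGamma 5 (by norm_num) (by norm_num)]
    exact (TorusTwists.CosetTable.tableFive_isValid.freelyGenerates_Gamma
      (by norm_num)).nonempty_mulEquiv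
  · rw [TorusTwists.N_one, Subgroup.index_top]
  · rw [hGamma 2 (by norm_num) (by norm_num)]
    exact TorusTwists.CosetTable.tableTwo_isValid.index_Gamma_of_neg_one_mem
      (TorusTwists.N_le_Gamma 2 TorusTwists.neg_one_mem_N_two)
  · rw [hGamma 3 (by norm_num) (by norm_num)]
    exact TorusTwists.CosetTable.tableThree_isValid.index_Gamma le_rfl
  · rw [hGamma 4 (by norm_num) (by norm_num)]
    exact TorusTwists.CosetTable.tableFour_isValid.index_Gamma (by norm_num)
  · rw [hGamma 5 (by norm_num) (by norm_num)]
    exact TorusTwists.CosetTable.tableFive_isValid.index_Gamma (by norm_num)
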